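/- Let $m,n\ge 1$ and let $X_i^{(j)}$, $1\le i\le n$, $1\le j\le m$, be independent random variables (not necessarily identically distributed) with values in a measurable space $(S,\mathcal S)$. For every $\mathbf i=(i_1,\dots,i_m)\in\{1,\dots,n\}^m$ let $h_{\mathbf i}:S^m\to\mathbb R$ be measurable, and write $h_{\mathbf i}$ also for the random variable $h_{\mathbf i}(X_{i_1}^{(1)},\dots,X_{i_m}^{(m)})$. For $J\subseteq\{1,\dots,m\}$ let $J^c$ be its complement, $\mathbf i_J=(i_j)_{j\in J}$, and let $\sum_{\mathbf i_J}$ and $\max_{\mathbf i_J}$ be the sum and the maximum over all $1\le i_j\le n$, $j\in J$. Let $E$ denote expectation and $E_J$ expectation with respect to the variables $X_i^{(j)}$, $j\in J$, $1\le i\le n$, only, with $E_j=E_{\{j\}}$ (an empty sum operation $\sum_{\mathbf i_\emptyset}$ and $E_\emptyset$ are the identity). **Theorem 2.5.** There exist universal constants $0<K_m<\infty$, depending only on $m$, such that the following holds. Let $p>2$, suppose that $E|h_{\mathbf i}|^p<\infty$ for all $\mathbf i$ and that the kernels are canonical, i.e. $E_jh_{\mathbf i}=0$ almost surely for all $\mathbf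 i$ and all $j=1,\dots,m$. Put $$t_0=\inf\Bigl\{t\ge 0:\ \Pr\Bigl\{\Bigl|\sum_{\mathbf i}h_{\mathbf i}\Bigr|>t\Bigr\}\le\Bigl(\frac34\Bigr)^{p/(p-2)}\frac1{(2K_m^p\,p^{mp/2})^{1/(p-2)}}\Bigr\}.$$ Then $$\max\Bigl\{\frac{t_0^p}{(4K_mp^{m/2})^{p/(p-2)}},\ 2^{-mp}\max_{\emptyset\ne J\subseteq\{1,\dots,m\}}E_J\max_{\mathbf i_J}\Bigl(\sum_{\mathbf i_{J^c}}E_{J^c}h_{\mathbf i}^2\Bigr)^{p/2}\Bigr\}\le E\Bigl|\sum_{\mathbf i}h_{\mathbf i}\Bigr|^p$$ and $$E\Bigl|\sum_{\mathbf i}h_{\mathbf i}\Bigr|^p\le 2K_m^p\Bigl\{(2p^{m/2})^p\,t_0^p+\sum_{\emptyset\ne J\subseteq\{1,\dots,m\}}p^{(m+|J|)p/2}\,E_J\max_{\mathbf i_J}\Bigl(\sum_{\mathbf i_{J^c}}E_{J^c}h_{\mathbf i}^2\Bigr)^{p/2}\Bigr\}.$$ -/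

import Mathlib

open MeasureTheory ProbabilityTheory
open scoped ENNReal

namespace DecoupledU

variable {Ω S : Type*} {m n : ℕ}

/-- `X_𝐢 = (X_{i₁}^{(1)}, …, X_{i_m}^{(m)})`: the coordinates of the array `x` picked out by the
multi-index `i`; the entry `x j i` stands for `x_i^{(j)}`. -/
def select (i : Fin m → Fin n) (x : Fin m → Fin n → S) : Fin m → S :=
  fun j => x j (i j)

/-- The array whose rows with index in `J` are those of `y` and whose other rows are those of `x`.
Integrating a function of `resample J x (X ω')` over `ω'` is the operation `E_J`
(expectation over the variables `X_i^{(j)}`, `j ∈ J`, only), the other rows being frozen at `x`. -/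
def resample (J : Finset (Fin m)) (x y : Fin m → Fin n → S) : Fin m → Fin n → S :=
  fun j i => if j ∈ J then y j i else x j i

/-- The array of values of the random variables `X_i^{(j)} = X j i` at `ω`. -/
def arr (X : Fin m → Fin n → Ω → S) (ω : Ω) : Fin m → Fin n → S :=
  fun j i => X j i ω

/-- The generalized decoupled U-statistic `∑_𝐢 h_𝐢(X_{i₁}^{(1)}, …, X_{i_m}^{(m)})`. -/
def uStat (X : Fin m → Fin n → Ω → S) (h : (Fin m → Fin n) → (Fin m → S) → ℝ) (ω : Ω) : ℝ :=
  ∑ i : Fin m → Fin n, h i (select i (arr X ω))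

variable [MeasurableSpace Ω]

/-- `E_j h_𝐢(X_𝐢) = 0` almost surely, for every multi-index `𝐢` and every `j`. -/
def IsCanonical (μ : Measure Ω) (X : Fin m → Fin n → Ω → S)
    (h : (Fin m → Fin n) → (Fin m → S) → ℝ) : Prop :=
  ∀ (i : Fin m → Fin n) (j : Fin m), ∀ᵐ ω ∂μ,
    ∫ ω', h i (select i (resample {j} (arr X ω) (arr X ω'))) ∂μ = 0

/-- `E_J h_𝐢²`, as a `[0, ∞]`-valued function of the array `x` (constant in the rows in `J`). -/
noncomputable def partialSq (μ : Measure Ω) (X : Fin m → Fin n → Ω → S)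
    (h : (Fin m → Fin n) → (Fin m → S) → ℝ) (J : Finset (Fin m)) (i : Fin m → Fin n)
    (x : Fin m → Fin n → S) : ℝ≥0∞ :=
  ∫⁻ ω', ENNReal.ofReal (h i (select i (resample J x (arr X ω'))) ^ 2) ∂μ

/-- `E_J max_{𝐢_J} (∑_{𝐢_{Jᶜ}} E_{Jᶜ} h_𝐢²)^{p/2}`. The maximum is over `k = 𝐢_J`, and the sum is
over the multi-indices `i` whose restriction to `J` is `k`. The integrand depends on the rows
in `J` only, so that its expectation is its `E_J`. -/
noncomputable def mixedMoment (μ : Measure Ω) (X : Fin m → Fin n → Ω → S)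
    (h : (Fin m → Fin n) → (Fin m → S) → ℝ) (p : ℝ) (J : Finset (Fin m)) : ℝ≥0∞ :=
  ∫⁻ ω, ⨆ k : J → Fin n,
    (∑ i : Fin m → Fin n with (∀ j : J, i j = k j), partialSq μ X h Jᶜ i (arr X ω)) ^ (p / 2) ∂μ

/-- The level `(3/4)^{p/(p-2)} / (2 K^p p^{mp/2})^{1/(p-2)}`. -/
noncomputable def level (K : ℝ) (m : ℕ) (p : ℝ) : ℝ :=
  (3 / 4 : ℝ) ^ (p / (p - 2)) * (1 / (2 * K ^ p * p ^ (m * p / 2)) ^ (1 / (p - 2)))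

/-- `t₀ = inf {t ≥ 0 : Pr{|∑_𝐢 h_𝐢| > t} ≤ level}`. -/
noncomputable def t0 (μ : Measure Ω) (X : Fin m → Fin n → Ω → S)
    (h : (Fin m → Fin n) → (Fin m → S) → ℝ) (K p : ℝ) : ℝ :=
  sInf {t : ℝ | 0 ≤ t ∧ μ.real {ω | t < |uStat X h ω|} ≤ level K m p}

end DecoupledU

set_option linter.unusedSectionVars false

namespace DecoupledU

/-! ### Moments of sums of independent nonnegative variables -/

section OneDim

variable {Ω κ : Type*} [MeasurableSpace Ω]

/-! Write `U` for the sum of the kernels, `Q` for the sum of their squares and `V` for the mean of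
`Q`. Since the kernels are canonical, freezing all rows but one leaves a sum of independent centered
variables, and inserting fixed signs there costs at most a factor `2 ^ p` in the `p`-th moment
(`lintegral_enorm_signed_sum_rpow_le`). Doing this in every row and averaging over the signs turns
`U` into a Rademacher chaos whose coefficients are the kernels. Khinchine's inequality iterated over
the rows then gives `E|U|^p ≤ 2^(mp) (4p)^(mp/2) E Q^(p/2)`, and the second moment of the chaos
gives `E Q^(p/2) ≤ 2^(mp) E|U|^p`. By Jensen, each mixed moment is at most `E Q^(p/2)`, so the
second estimate yields one half of the lower bound. The other half is Markov's inequality just below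
`t0`.

For the upper bound, `E Q^(p/2)` is a moment of order `r = p/2` of a sum of nonnegative kernels. In
one row, a Rosenthal inequality bounds it by `C^r (∑ E ξ)^r` and `(C r)^r ∑ E ξ^r`, and the last sum
can be traded for the moment of the maximum. Iterating over the rows (`expOp_rpow_sumOp_le`)
produces every set `J` of maximized rows, with weight `r^(|J| r)`. Together with the Khinchine
factor this is the announced `p^((m+|J|)p/2)`, but the term `J = ∅`, which is `V^(p/2)`, is still
present.

That term is removed in `CanonicalFamily.lintegral_rpow_le_sInf`. If the nonempty `J` together
dominate it, nothing is left to do. Otherwise `V^(p/2)` dominates every mixed moment, and the same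
inequality at the exponent `q = min p 4` becomes hypercontractivity, `E|U|^q ≤ D V^(q/2)` with `D`
depending on `m` only. A Paley-Zygmund argument (`le_sq_of_tail_le`) then bounds `V` by a multiple
of `t^2` as soon as `Pr{|U| > t}` is below the level, hence by a multiple of `t0^2`. -/

theorem add_rpow_le_three_mul {r : ℝ} (hr : 1 ≤ r) (a b : ℝ≥0∞) :
    (a + b) ^ (r - 1) ≤ 3 * b ^ (r - 1) + (2 * ENNReal.ofReal r) ^ (r - 1) * a ^ (r - 1) := by
  have hr0 : 0 < r := by linarith
  have hr1 : 0 ≤ r - 1 := by linarith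
  -- If `r a ≤ b`, the loss is `(1 + 1/r)^(r-1) ≤ e`, so the constant at `b` does not grow with `r`;
  -- otherwise `a + b ≤ 2 r a`.
  rcases le_total (ENNReal.ofReal r * a) b with h | h
  · refine le_trans ?_ le_self_add
    have h1 : a + b ≤ ENNReal.ofReal (1 + 1 / r) * b := by
      rw [ENNReal.ofReal_add zero_le_one (by positivity), add_mul, ENNReal.ofReal_one, one_mul,
        add_comm]
      gcongr
      calc a = ENNReal.ofReal (1 / r) * (ENNReal.ofReal r * a) := by
            rw [← mul_assoc, ← ENNReal.ofReal_mul (by positivity)]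
            simp [hr0.ne']
        _ ≤ _ := by gcongr
    calc (a + b) ^ (r - 1) ≤ (ENNReal.ofReal (1 + 1 / r) * b) ^ (r - 1) := by gcongr
      _ = ENNReal.ofReal ((1 + 1 / r) ^ (r - 1)) * b ^ (r - 1) := by
          rw [ENNReal.mul_rpow_of_nonneg _ _ hr1, ENNReal.ofReal_rpow_of_nonneg (by positivity) hr1]
      _ ≤ 3 * b ^ (r - 1) := by
          gcongr
          rw [show (3 : ℝ≥0∞) = ENNReal.ofReal 3 by norm_num]
          apply ENNReal.ofReal_le_ofReal
          calc (1 + 1 / r) ^ (r - 1) ≤ (Real.exp (1 / r)) ^ (r - 1) := by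
                gcongr
                linarith [Real.add_one_le_exp (1 / r)]
            _ = Real.exp (1 / r * (r - 1)) := by rw [Real.exp_mul]
            _ ≤ Real.exp 1 := by
                gcongr
                rw [div_mul_eq_mul_div, div_le_iff₀ hr0]; linarith
            _ ≤ 3 := by linarith [Real.exp_one_lt_d9]
  · refine le_trans ?_ le_add_self
    rw [← ENNReal.mul_rpow_of_nonneg _ _ hr1]
    gcongr
    have : a ≤ ENNReal.ofReal r * a := by
      nth_rewrite 1 [← one_mul a]
      gcongr
      simpa using hr
    calc a + b ≤ ENNReal.ofReal r * a + ENNReal.ofReal r * a := by gcongr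
      _ = _ := by ring

theorem lintegral_rpow_le_rpow_lintegral {μ : Measure Ω} [IsProbabilityMeasure μ]
    {f : Ω → ℝ≥0∞} (hf : AEMeasurable f μ) {s t : ℝ} (hs : 0 ≤ s) (hst : s ≤ t) :
    ∫⁻ ω, f ω ^ s ∂μ ≤ (∫⁻ ω, f ω ^ t ∂μ) ^ (s / t) := by
  rcases hs.eq_or_lt with rfl | hs
  · simp
  have h := eLpNorm'_le_eLpNorm'_of_exponent_le hs hst μ hf.aestronglyMeasurable
  simp only [eLpNorm', enorm_eq_self] at h
  calc ∫⁻ ω, f ω ^ s ∂μ = ((∫⁻ ω, f ω ^ s ∂μ) ^ (1 / s)) ^ s := by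
        rw [← ENNReal.rpow_mul, one_div_mul_cancel hs.ne', ENNReal.rpow_one]
    _ ≤ ((∫⁻ ω, f ω ^ t ∂μ) ^ (1 / t)) ^ s := by gcongr
    _ = _ := by rw [← ENNReal.rpow_mul]; congr 1; ring

theorem rpow_lintegral_le {μ : Measure Ω} [IsProbabilityMeasure μ]
    {f : Ω → ℝ≥0∞} (hf : AEMeasurable f μ) {r : ℝ} (hr : 1 ≤ r) :
    (∫⁻ ω, f ω ∂μ) ^ r ≤ ∫⁻ ω, f ω ^ r ∂μ := by
  have h := lintegral_rpow_le_rpow_lintegral hf zero_le_one hr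
  simp only [ENNReal.rpow_one] at h
  calc _ ≤ ((∫⁻ ω, f ω ^ r ∂μ) ^ (1 / r)) ^ r := by gcongr
    _ = _ := by rw [← ENNReal.rpow_mul, one_div_mul_cancel (by linarith), ENNReal.rpow_one]

variable [Fintype κ] [DecidableEq κ]

theorem sum_eq_add_sum_erase (a : κ → ℝ≥0∞) (k : κ) :
    ∑ l, a l = a k + ∑ l ∈ Finset.univ.erase k, a l :=
  (Finset.add_sum_erase _ _ (Finset.mem_univ k)).symm

theorem indepFun_sum_erase {μ : Measure Ω} {ξ : κ → Ω → ℝ≥0∞} (hξ : ∀ k, Measurable (ξ k))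
    (hind : iIndepFun ξ μ) (k : κ) :
    IndepFun (ξ k) (fun ω => ∑ l ∈ Finset.univ.erase k, ξ l ω) μ := by
  have := (hind.indepFun_finsetSum_of_notMem hξ (Finset.notMem_erase k Finset.univ)).symm
  convert this using 1
  ext ω
  simp

/-- Rosenthal's inequality. Write the `r`-th power of the sum as `∑ ξ k * (∑ ξ l)^(r-1)` and
separate `ξ k` from the remaining sum, which is independent of it. The resulting self-bounding
inequality for the moment is solved by asking which of its two terms dominates. The factor `r^r`
falls only on the sum of the individual moments. -/
theorem rpow_sum_le_of_indep {μ : Measure Ω} [IsProbabilityMeasure μ] {ξ : κ → Ω → ℝ≥0∞}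
    (hξ : ∀ k, Measurable (ξ k)) (hind : iIndepFun ξ μ) {r : ℝ} (hr : 1 ≤ r) :
    ∫⁻ ω, (∑ k, ξ k ω) ^ r ∂μ ≤ 6 ^ r * (∑ k, ∫⁻ ω, ξ k ω ∂μ) ^ r
      + 2 * (2 * ENNReal.ofReal r) ^ r * ∑ k, ∫⁻ ω, ξ k ω ^ r ∂μ := by
  have hr0 : 0 < r := by linarith
  have hr1 : 0 ≤ r - 1 := by linarith
  have hρ : (1 : ℝ≥0∞) ≤ 2 * ENNReal.ofReal r := by
    rw [show (2 : ℝ≥0∞) = ENNReal.ofReal 2 by norm_num, ← ENNReal.ofReal_mul (by norm_num)]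
    exact ENNReal.one_le_ofReal.2 (by linarith)
  have hρt : 2 * ENNReal.ofReal r ≠ ∞ := by finiteness
  set y := ∫⁻ ω, (∑ k, ξ k ω) ^ r ∂μ with hy
  set A := ∑ k, ∫⁻ ω, ξ k ω ∂μ with hA
  set T := ∑ k, ∫⁻ ω, ξ k ω ^ r ∂μ with hT
  -- The final division by a power of `y` needs `y` finite; if it is infinite, convexity makes `T`
  -- infinite too.
  rcases eq_or_ne y ∞ with htop | htop
  · have h1 : y ≤ (Fintype.card κ : ℝ≥0∞) ^ (r - 1) * T := by
      calc y ≤ ∫⁻ ω, (Fintype.card κ : ℝ≥0∞) ^ (r - 1) * ∑ k, ξ k ω ^ r ∂μ :=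
            lintegral_mono fun ω => ENNReal.rpow_sum_le_const_mul_sum_rpow Finset.univ _ hr
        _ = _ := by
            rw [lintegral_const_mul _ (by fun_prop), lintegral_finsetSum _ (by fun_prop)]
    have hT : T = ∞ := by
      by_contra hne
      rw [htop, top_le_iff] at h1
      exact absurd h1 (by finiteness)
    rw [hT, ENNReal.mul_top]
    · simp
    · have : (2 * ENNReal.ofReal r) ^ r ≠ 0 := by
        have := ENNReal.one_le_rpow hρ hr0
        exact (lt_of_lt_of_le (zero_lt_one' ℝ≥0∞) this).ne'
      simp [this]
  have key : y ≤ 3 * A * y ^ ((r - 1) / r) + (2 * ENNReal.ofReal r) ^ r * T := by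
    have e1 : y = ∑ k, ∫⁻ ω, ξ k ω * (∑ l, ξ l ω) ^ (r - 1) ∂μ := by
      rw [hy, ← lintegral_finsetSum _ (by fun_prop)]
      refine lintegral_congr fun ω => ?_
      rw [← Finset.sum_mul]
      nth_rewrite 1 [show r = 1 + (r - 1) by ring]
      rw [ENNReal.rpow_add_of_nonneg _ _ zero_le_one hr1, ENNReal.rpow_one]
    have e2 : 3 * A * y ^ ((r - 1) / r) + (2 * ENNReal.ofReal r) ^ r * T
        = ∑ k, (3 * (∫⁻ ω, ξ k ω ∂μ) * y ^ ((r - 1) / r)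
          + (2 * ENNReal.ofReal r) ^ r * ∫⁻ ω, ξ k ω ^ r ∂μ) := by
      rw [Finset.sum_add_distrib, hA, hT, Finset.mul_sum, Finset.mul_sum, Finset.sum_mul]
    rw [e2]
    refine e1.le.trans (Finset.sum_le_sum fun k _ => ?_)
    calc ∫⁻ ω, ξ k ω * (∑ l, ξ l ω) ^ (r - 1) ∂μ
        ≤ ∫⁻ ω, 3 * (ξ k ω * (∑ l ∈ Finset.univ.erase k, ξ l ω) ^ (r - 1))
            + (2 * ENNReal.ofReal r) ^ r * ξ k ω ^ r ∂μ := by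
          refine lintegral_mono fun ω => ?_
          rw [sum_eq_add_sum_erase (fun l => ξ l ω) k]
          calc _ ≤ ξ k ω * (3 * (∑ l ∈ Finset.univ.erase k, ξ l ω) ^ (r - 1)
                + (2 * ENNReal.ofReal r) ^ (r - 1) * ξ k ω ^ (r - 1)) := by
                gcongr; exact add_rpow_le_three_mul hr _ _
            _ = 3 * (ξ k ω * (∑ l ∈ Finset.univ.erase k, ξ l ω) ^ (r - 1))
                + (2 * ENNReal.ofReal r) ^ (r - 1) * (ξ k ω ^ (1 : ℝ) * ξ k ω ^ (r - 1)) := by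
                rw [ENNReal.rpow_one]; ring
            _ ≤ _ := by
                rw [← ENNReal.rpow_add_of_nonneg _ _ zero_le_one hr1]
                simp only [add_sub_cancel]
                gcongr
                linarith
      _ = 3 * (∫⁻ ω, ξ k ω ∂μ) * (∫⁻ ω, (∑ l ∈ Finset.univ.erase k, ξ l ω) ^ (r - 1) ∂μ)
            + (2 * ENNReal.ofReal r) ^ r * ∫⁻ ω, ξ k ω ^ r ∂μ := by
          rw [lintegral_add_left (by fun_prop), lintegral_const_mul _ (by fun_prop),
            lintegral_const_mul _ (by fun_prop), mul_assoc]
          congr 2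
          have hI := (indepFun_sum_erase hξ hind k).comp measurable_id
            (measurable_id.pow_const (r - 1))
          exact lintegral_mul_eq_lintegral_mul_lintegral_of_indepFun'' (by fun_prop)
            (by fun_prop) hI
      _ ≤ _ := by
          gcongr
          calc _ ≤ ∫⁻ ω, (∑ l, ξ l ω) ^ (r - 1) ∂μ := by
                refine lintegral_mono fun ω => ?_
                dsimp only
                gcongr
                exact Finset.erase_subset _ _
            _ ≤ _ := lintegral_rpow_le_rpow_lintegral (by fun_prop) hr1 (by linarith)
  rcases eq_or_ne y 0 with h0 | h0
  · simp [h0]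
  have hpow : y = y ^ ((r - 1) / r) * y ^ (1 / r) := by
    rw [← ENNReal.rpow_add _ _ h0 htop, ← add_div, sub_add_cancel, div_self hr0.ne',
      ENNReal.rpow_one]
  set z := y ^ ((r - 1) / r)
  have hz0 : z ≠ 0 := (ENNReal.rpow_pos (pos_iff_ne_zero.2 h0) htop).ne'
  have hzt : z ≠ ∞ := ENNReal.rpow_ne_top_of_nonneg (by positivity) htop
  rcases le_total (3 * A * z) ((2 * ENNReal.ofReal r) ^ r * T) with h | h
  · refine le_trans (key.trans ?_) le_add_self
    calc _ ≤ (2 * ENNReal.ofReal r) ^ r * T + (2 * ENNReal.ofReal r) ^ r * T := by gcongr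
      _ = _ := by ring
  · refine le_trans ?_ le_self_add
    have h2 : z * y ^ (1 / r) ≤ z * (6 * A) := by
      rw [← hpow]
      calc y ≤ 3 * A * z + 3 * A * z := key.trans (by gcongr)
        _ = _ := by ring
    have h3 : y ^ (1 / r) ≤ 6 * A := (ENNReal.mul_le_mul_iff_right hz0 hzt).1 h2
    calc y = (y ^ (1 / r)) ^ r := by
          rw [← ENNReal.rpow_mul, one_div_mul_cancel hr0.ne', ENNReal.rpow_one]
      _ ≤ (6 * A) ^ r := by gcongr
      _ = _ := ENNReal.mul_rpow_of_nonneg _ _ hr0.le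

theorem mul_rpow_le_young {r : ℝ} (hr : 1 ≤ r) {R : ℝ≥0∞} (hR : 1 ≤ R) (hRt : R ≠ ∞)
    (A N : ℝ≥0∞) : A * N ^ (r - 1) ≤ R * N ^ r + R ^ (1 - r) * A ^ r := by
  have hr1 : 0 ≤ r - 1 := by linarith
  have hR0 : R ≠ 0 := (lt_of_lt_of_le zero_lt_one hR).ne'
  rcases le_total A (R * N) with h | h
  · refine le_trans ?_ le_self_add
    calc A * N ^ (r - 1) ≤ R * N * N ^ (r - 1) := by gcongr
      _ = R * (N ^ (1 : ℝ) * N ^ (r - 1)) := by rw [ENNReal.rpow_one]; ring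
      _ = _ := by rw [← ENNReal.rpow_add_of_nonneg _ _ zero_le_one hr1]; simp
  · refine le_trans ?_ le_add_self
    have hN : N ≤ R⁻¹ * A := by
      calc N = R⁻¹ * (R * N) := by rw [← mul_assoc, ENNReal.inv_mul_cancel hR0 hRt, one_mul]
        _ ≤ _ := by gcongr
    calc A * N ^ (r - 1) ≤ A * (R⁻¹ * A) ^ (r - 1) := by gcongr
      _ = (R⁻¹) ^ (r - 1) * (A ^ (1 : ℝ) * A ^ (r - 1)) := by
          rw [ENNReal.mul_rpow_of_nonneg _ _ hr1, ENNReal.rpow_one]; ring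
      _ = _ := by
          rw [← ENNReal.rpow_add_of_nonneg _ _ zero_le_one hr1, ENNReal.inv_rpow,
            ← ENNReal.rpow_neg]
          simp

/-- The maximal entry is paid for separately. If some other index satisfies the condition, its
complementary sum contains the maximum, so the whole sum is at most `4 A`, and one factor of each
remaining power can be summed. If none does, the remaining terms vanish. -/
theorem sum_ite_rpow_le {r : ℝ} (hr : 1 ≤ r) (a : κ → ℝ≥0∞) (A : ℝ≥0∞) :
    ∑ k, (if ∑ l ∈ Finset.univ.erase k, a l ≤ 2 * A then a k ^ r else 0)
      ≤ (⨆ k, a k) ^ r + 4 * (A * (⨆ k, a k) ^ (r - 1)) := by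
  have hr1 : 0 ≤ r - 1 := by linarith
  rcases isEmpty_or_nonempty κ with hκ | hκ
  · simp
  obtain ⟨k₀, hk₀⟩ := Finite.exists_max a
  have hN : (⨆ k, a k) = a k₀ := le_antisymm (iSup_le hk₀) (le_iSup a k₀)
  rw [hN, sum_eq_add_sum_erase _ k₀]
  gcongr
  · split_ifs <;> simp
  by_cases hex : ∃ k ∈ Finset.univ.erase k₀, ∑ l ∈ Finset.univ.erase k, a l ≤ 2 * A
  · obtain ⟨k, hk, hkA⟩ := hex
    have hkk : k ≠ k₀ := Finset.ne_of_mem_erase hk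
    have hZ : ∑ l, a l ≤ 4 * A := by
      rw [sum_eq_add_sum_erase a k]
      have : a k ≤ ∑ l ∈ Finset.univ.erase k, a l :=
        (hk₀ k).trans (Finset.single_le_sum_of_canonicallyOrdered
          (Finset.mem_erase.2 ⟨hkk.symm, Finset.mem_univ _⟩))
      calc _ ≤ 2 * A + 2 * A := by gcongr; exact this.trans hkA
        _ = _ := by ring
    calc _ ≤ ∑ l ∈ Finset.univ.erase k₀, a l * a k₀ ^ (r - 1) := by
          gcongr with l
          split_ifs
          · nth_rewrite 1 [show r = 1 + (r - 1) by ring]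
            rw [ENNReal.rpow_add_of_nonneg _ _ zero_le_one hr1, ENNReal.rpow_one]
            gcongr
            exact hk₀ l
          · simp
      _ = (∑ l ∈ Finset.univ.erase k₀, a l) * a k₀ ^ (r - 1) := by rw [Finset.sum_mul]
      _ ≤ (4 * A) * a k₀ ^ (r - 1) := by
          gcongr
          refine le_trans ?_ hZ
          gcongr
          exact Finset.erase_subset _ _
      _ = _ := by ring
  · push Not at hex
    rw [Finset.sum_eq_zero]
    · simp
    · intro k hk
      rw [if_neg (not_le.2 (hex k hk))]

/-- Trades the sum of moments for the moment of the maximum. By Markov the sum of the other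
variables is at most `2 A` with probability at least `1/2`, independently of `ξ k`, so restricting
to that event at most halves `E ξ k ^ r`. There the deterministic bound applies, followed by Young's
inequality. The weight `R` is left free so that `R^(1-r)` can later absorb powers of `r`. -/
theorem sum_rpow_le_of_indep {μ : Measure Ω} [IsProbabilityMeasure μ] {ξ : κ → Ω → ℝ≥0∞}
    (hξ : ∀ k, Measurable (ξ k)) (hind : iIndepFun ξ μ) {r : ℝ} (hr : 1 ≤ r)
    {R : ℝ≥0∞} (hR : 1 ≤ R) (hRt : R ≠ ∞) :
    ∑ k, ∫⁻ ω, ξ k ω ^ r ∂μ ≤ 10 * R * ∫⁻ ω, (⨆ k, ξ k ω) ^ r ∂μ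
      + 8 * R ^ (1 - r) * (∑ k, ∫⁻ ω, ξ k ω ∂μ) ^ r := by
  have hr0 : 0 < r := by linarith
  have hR0 : R ≠ 0 := (lt_of_lt_of_le zero_lt_one hR).ne'
  set A := ∑ k, ∫⁻ ω, ξ k ω ∂μ with hA
  rcases eq_or_ne A ∞ with htop | htop
  · rw [htop, ENNReal.top_rpow_of_pos hr0, ENNReal.mul_top]
    · simp
    · have : R ^ (1 - r) ≠ 0 := (ENNReal.rpow_pos (pos_iff_ne_zero.2 hR0) hRt).ne'
      simp [this]
  rcases eq_or_ne A 0 with h0 | h0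
  · have : ∀ k, ∫⁻ ω, ξ k ω ^ r ∂μ = 0 := by
      intro k
      have h1 : ∫⁻ ω, ξ k ω ∂μ = 0 := by
        have := Finset.sum_eq_zero_iff.1 (hA.symm.trans h0) k (Finset.mem_univ k)
        exact this
      rw [lintegral_eq_zero_iff (hξ k)] at h1
      rw [lintegral_eq_zero_iff (by fun_prop)]
      filter_upwards [h1] with ω hω
      simp only [Pi.zero_apply] at hω ⊢
      rw [hω, ENNReal.zero_rpow_of_pos hr0]
    simp [this]
  have step : ∀ k, ∫⁻ ω, ξ k ω ^ r ∂μ ≤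
      2 * ∫⁻ ω, (if ∑ l ∈ Finset.univ.erase k, ξ l ω ≤ 2 * A then ξ k ω ^ r else 0) ∂μ := by
    intro k
    set Z : Ω → ℝ≥0∞ := fun ω => ∑ l ∈ Finset.univ.erase k, ξ l ω with hZ
    have hZm : Measurable Z := by fun_prop
    set φ : ℝ≥0∞ → ℝ≥0∞ := fun z => if z ≤ 2 * A then 1 else 0 with hφ
    have hφm : Measurable φ := Measurable.ite measurableSet_Iic measurable_const measurable_const
    have hI := (indepFun_sum_erase hξ hind k).comp (measurable_id.pow_const r) hφm
    have e : ∫⁻ ω, (if Z ω ≤ 2 * A then ξ k ω ^ r else 0) ∂μ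
        = (∫⁻ ω, ξ k ω ^ r ∂μ) * ∫⁻ ω, φ (Z ω) ∂μ := by
      refine Eq.trans ?_ (lintegral_mul_eq_lintegral_mul_lintegral_of_indepFun'' (by fun_prop)
        (hφm.comp hZm).aemeasurable hI)
      refine lintegral_congr fun ω => ?_
      simp only [hφ, mul_ite, mul_one, mul_zero]
    have hEZ : ∫⁻ ω, Z ω ∂μ ≤ A := by
      rw [hZ, lintegral_finsetSum _ (by fun_prop), hA]
      gcongr
      exact Finset.erase_subset _ _
    -- Markov's inequality without subtraction: integrate `2A ≤ 2A φ(Z) + Z`, then cancel `A`, which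
    -- is neither `0` nor `∞` here.
    have hhalf : (1 : ℝ≥0∞) ≤ 2 * ∫⁻ ω, φ (Z ω) ∂μ := by
      have h1 : ∫⁻ _ω, (2 * A) ∂μ ≤ ∫⁻ ω, (2 * A) * φ (Z ω) + Z ω ∂μ := by
        refine lintegral_mono fun ω => ?_
        simp only [hφ]
        split_ifs with h
        · simp
        · simpa using (not_le.1 h).le
      have hφZ : Measurable fun ω => φ (Z ω) := hφm.comp hZm
      rw [lintegral_add_right _ hZm, lintegral_const_mul _ hφZ] at h1
      simp only [lintegral_const, measure_univ, mul_one] at h1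
      have h2 : A + A ≤ A * (2 * ∫⁻ ω, φ (Z ω) ∂μ) + A := by
        calc A + A = 2 * A := by ring
          _ ≤ _ := h1
          _ ≤ 2 * A * ∫⁻ ω, φ (Z ω) ∂μ + A := by gcongr
          _ = _ := by ring
      have h3 := (ENNReal.add_le_add_iff_right htop).1 h2
      nth_rewrite 1 [← mul_one A] at h3
      exact (ENNReal.mul_le_mul_iff_right h0 htop).1 h3
    calc ∫⁻ ω, ξ k ω ^ r ∂μ = (∫⁻ ω, ξ k ω ^ r ∂μ) * 1 := (mul_one _).symm
      _ ≤ (∫⁻ ω, ξ k ω ^ r ∂μ) * (2 * ∫⁻ ω, φ (Z ω) ∂μ) := by gcongr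
      _ = 2 * ((∫⁻ ω, ξ k ω ^ r ∂μ) * ∫⁻ ω, φ (Z ω) ∂μ) := by ring
      _ = _ := by rw [← e]
  have hmeas : ∀ k, Measurable fun ω =>
      (if ∑ l ∈ Finset.univ.erase k, ξ l ω ≤ 2 * A then ξ k ω ^ r else 0) := fun k =>
    Measurable.ite (measurableSet_le (by fun_prop) measurable_const) (by fun_prop) measurable_const
  have hsup : Measurable fun ω => ⨆ k, ξ k ω := .iSup hξ
  calc ∑ k, ∫⁻ ω, ξ k ω ^ r ∂μ
      ≤ ∑ k, 2 * ∫⁻ ω, (if ∑ l ∈ Finset.univ.erase k, ξ l ω ≤ 2 * A then ξ k ω ^ r else 0) ∂μ :=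
        Finset.sum_le_sum fun k _ => step k
    _ = 2 * ∫⁻ ω, ∑ k,
          (if ∑ l ∈ Finset.univ.erase k, ξ l ω ≤ 2 * A then ξ k ω ^ r else 0) ∂μ := by
        rw [← Finset.mul_sum, lintegral_finsetSum _ (fun k _ => hmeas k)]
    _ ≤ 2 * ∫⁻ ω, (5 * R) * (⨆ k, ξ k ω) ^ r + 4 * R ^ (1 - r) * A ^ r ∂μ := by
        gcongr with ω
        refine (sum_ite_rpow_le hr (fun k => ξ k ω) A).trans ?_
        calc _ ≤ R * (⨆ k, ξ k ω) ^ r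
              + 4 * (R * (⨆ k, ξ k ω) ^ r + R ^ (1 - r) * A ^ r) := by
              gcongr
              · nth_rewrite 1 [← one_mul ((⨆ k, ξ k ω) ^ r)]
                gcongr
              · exact mul_rpow_le_young hr hR hRt _ _
          _ = _ := by ring
    _ = _ := by
        rw [lintegral_add_right _ measurable_const, lintegral_const_mul _ (by fun_prop)]
        simp only [lintegral_const, measure_univ, mul_one]
        ring

end OneDim

/-! ### Sums, maxima and expectations over sets of rows -/

section Operators

variable {ι κ S : Type*} [Fintype ι] [DecidableEq ι] [Fintype κ] [DecidableEq κ]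
  [MeasurableSpace S]

/-- The multi-indices which agree with `i` off `J`. -/
def idxClass (J : Finset ι) (i : ι → κ) : Finset (ι → κ) :=
  Finset.univ.filter fun i' => ∀ j ∉ J, i' j = i j

theorem mem_idxClass {J : Finset ι} {i i' : ι → κ} :
    i' ∈ idxClass J i ↔ ∀ j ∉ J, i' j = i j := by simp [idxClass]

/-- Summation over the indices `i_j`, `j ∈ J`. -/
noncomputable def sumOp (J : Finset ι) (F : (ι → κ) → (ι → κ → S) → ℝ≥0∞) (i : ι → κ)
    (x : ι → κ → S) : ℝ≥0∞ :=
  ∑ i' ∈ idxClass J i, F i' x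

/-- Maximum over the indices `i_j`, `j ∈ J`. -/
noncomputable def maxOp (J : Finset ι) (F : (ι → κ) → (ι → κ → S) → ℝ≥0∞) (i : ι → κ)
    (x : ι → κ → S) : ℝ≥0∞ :=
  ⨆ i' ∈ idxClass J i, F i' x

/-- Expectation over the rows `x_j`, `j ∈ J`. -/
noncomputable def expOp (ν : ι → Measure (κ → S)) (J : Finset ι)
    (F : (ι → κ) → (ι → κ → S) → ℝ≥0∞) (i : ι → κ) (x : ι → κ → S) : ℝ≥0∞ :=
  (∫⋯∫⁻_J, F i ∂ν) x

/-- `F i x` depends on row `j` of `x` through its entry `x j (i j)` only. -/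
def AdaptedAt (j : ι) (F : (ι → κ) → (ι → κ → S) → ℝ≥0∞) : Prop :=
  ∀ i x y y', y (i j) = y' (i j) → F i (Function.update x j y) = F i (Function.update x j y')

variable {F G : (ι → κ) → (ι → κ → S) → ℝ≥0∞} {J K : Finset ι} {j : ι}
  {ν : ι → Measure (κ → S)}

theorem idxClass_empty (i : ι → κ) : idxClass ∅ i = {i} := by
  ext i'; simp [mem_idxClass, funext_iff]

theorem sumOp_empty : sumOp ∅ F = F := by
  ext i x; simp [sumOp, idxClass_empty]

theorem maxOp_empty : maxOp ∅ F = F := by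
  ext i x; simp [maxOp, idxClass_empty]

theorem expOp_empty : expOp ν ∅ F = F := by
  ext i x; simp [expOp]

theorem mem_idxClass_update (hj : j ∉ J) {i i' : ι → κ} {k : κ} :
    i' ∈ idxClass J (Function.update i j k) ↔ i' ∈ idxClass (insert j J) i ∧ i' j = k := by
  simp only [mem_idxClass, Finset.mem_insert, not_or, and_imp]
  constructor
  · intro h
    refine ⟨fun l hl hlJ => ?_, ?_⟩
    · rw [h l hlJ, Function.update_of_ne hl]
    · rw [h j hj, Function.update_self]
  · rintro ⟨h, rfl⟩ l hl
    rcases eq_or_ne l j with rfl | hlj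
    · simp
    · rw [h l hlj hl, Function.update_of_ne hlj]

theorem sumOp_insert (hj : j ∉ J) (i : ι → κ) (x : ι → κ → S) :
    sumOp (insert j J) F i x = ∑ k, sumOp J F (Function.update i j k) x := by
  simp only [sumOp]
  rw [← Finset.sum_fiberwise (idxClass (insert j J) i) (fun i' => i' j)]
  refine Finset.sum_congr rfl fun k _ => Finset.sum_congr ?_ fun _ _ => rfl
  ext i'
  rw [Finset.mem_filter, mem_idxClass_update hj]

theorem sumOp_singleton (i : ι → κ) (x : ι → κ → S) :
    sumOp {j} F i x = ∑ k, F (Function.update i j k) x := by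
  have := sumOp_insert (F := F) (Finset.notMem_empty j) i x
  simpa [sumOp_empty] using this

theorem sumOp_insert_left (hj : j ∉ J) : sumOp (insert j J) F = sumOp {j} (sumOp J F) := by
  ext i x
  rw [sumOp_insert hj, sumOp_singleton]

theorem sumOp_union (h : Disjoint J K) : sumOp (J ∪ K) F = sumOp J (sumOp K F) := by
  induction J using Finset.induction_on with
  | empty => simp [sumOp_empty]
  | insert j J hj ih =>
    rw [Finset.disjoint_insert_left] at h
    rw [Finset.insert_union, sumOp_insert_left (by simp [hj, h.1]), ih h.2, sumOp_insert_left hj]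

theorem sumOp_comm (h : Disjoint J K) : sumOp J (sumOp K F) = sumOp K (sumOp J F) := by
  rw [← sumOp_union h, Finset.union_comm, sumOp_union h.symm]

theorem iSup_maxOp_update_le (hj : j ∉ J) (i : ι → κ) (x : ι → κ → S) :
    ⨆ k, maxOp J F (Function.update i j k) x ≤ maxOp (insert j J) F i x := by
  refine iSup_le fun k => iSup₂_le fun i' hi' => ?_
  exact le_iSup₂ (f := fun i' (_ : i' ∈ idxClass (insert j J) i) => F i' x) i'
    ((mem_idxClass_update hj).1 hi').1

theorem maxOp_le_sumOp : maxOp J F ≤ sumOp J F := fun _ x =>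
  iSup₂_le fun _ hi' => Finset.single_le_sum_of_canonicallyOrdered
    (f := fun i' => F i' x) hi'

theorem sumOp_mono (h : F ≤ G) : sumOp J F ≤ sumOp J G := fun _ x =>
  Finset.sum_le_sum fun i' _ => h i' x

theorem expOp_mono (h : F ≤ G) : expOp ν J F ≤ expOp ν J G := fun i x =>
  lmarginal_mono (h i) x

theorem measurable_sumOp (hF : ∀ i, Measurable (F i)) (i : ι → κ) : Measurable (sumOp J F i) := by
  unfold sumOp; fun_prop

theorem measurable_maxOp (hF : ∀ i, Measurable (F i)) (i : ι → κ) : Measurable (maxOp J F i) :=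
  .iSup fun i' => .iSup fun _ => hF i'

variable [∀ j, IsProbabilityMeasure (ν j)]

theorem measurable_expOp (hF : ∀ i, Measurable (F i)) (i : ι → κ) :
    Measurable (expOp ν J F i) := (hF i).lmarginal ν

theorem expOp_union (hF : ∀ i, Measurable (F i)) (h : Disjoint J K) :
    expOp ν (J ∪ K) F = expOp ν J (expOp ν K F) := by
  ext i x
  simp only [expOp, lmarginal_union ν (F i) (hF i) h]
  rfl

theorem expOp_comm (hF : ∀ i, Measurable (F i)) (h : Disjoint J K) :
    expOp ν J (expOp ν K F) = expOp ν K (expOp ν J F) := by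
  rw [← expOp_union hF h, Finset.union_comm, expOp_union hF h.symm]

theorem expOp_singleton (i : ι → κ) (x : ι → κ → S) :
    expOp ν {j} F i x = ∫⁻ y, F i (Function.update x j y) ∂ν j := by
  simp only [expOp, lmarginal_singleton]

theorem expOp_sumOp (hF : ∀ i, Measurable (F i)) :
    expOp ν J (sumOp K F) = sumOp K (expOp ν J F) := by
  ext i x
  simp only [expOp, sumOp, lmarginal]
  rw [lintegral_finsetSum]
  intro i' _
  exact (hF i').comp measurable_updateFinset

theorem expOp_const_mul (hF : ∀ i, Measurable (F i)) (c : ℝ≥0∞) :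
    expOp ν J (fun i x => c * F i x) = fun i x => c * expOp ν J F i x := by
  ext i x
  exact lintegral_const_mul _ ((hF i).comp measurable_updateFinset)

theorem expOp_add (hF : ∀ i, Measurable (F i)) :
    expOp ν J (fun i x => F i x + G i x) = fun i x => expOp ν J F i x + expOp ν J G i x := by
  ext i x
  exact lintegral_add_left ((hF i).comp measurable_updateFinset) _

theorem rpow_expOp_le (hF : ∀ i, Measurable (F i)) {r : ℝ} (hr : 1 ≤ r) (i : ι → κ)
    (x : ι → κ → S) : expOp ν J F i x ^ r ≤ expOp ν J (fun i x => F i x ^ r) i x :=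
  rpow_lintegral_le (((hF i).comp measurable_updateFinset).aemeasurable) hr

theorem AdaptedAt.sumOp (h : AdaptedAt j F) (hj : j ∉ J) : AdaptedAt j (sumOp J F) := by
  intro i x y y' hy
  refine Finset.sum_congr rfl fun i' hi' => h i' x y y' ?_
  rw [mem_idxClass.1 hi' j hj, hy]

theorem AdaptedAt.maxOp (h : AdaptedAt j F) (hj : j ∉ J) : AdaptedAt j (maxOp J F) := by
  intro i x y y' hy
  refine iSup_congr fun i' => iSup_congr fun hi' => h i' x y y' ?_
  rw [mem_idxClass.1 hi' j hj, hy]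

theorem AdaptedAt.expOp (h : AdaptedAt j F) (hF : ∀ i, Measurable (F i)) (hj : j ∉ J) :
    AdaptedAt j (expOp ν J F) := by
  intro i x y y' hy
  simp only [DecoupledU.expOp]
  rw [lmarginal_update_of_notMem (hF i) hj, lmarginal_update_of_notMem (hF i) hj]
  congr 1
  ext z
  exact h i z y y' hy

/-- Sum over the indices and expectation over the rows in `J`. -/
noncomputable def sumExp (ν : ι → Measure (κ → S)) (J : Finset ι)
    (F : (ι → κ) → (ι → κ → S) → ℝ≥0∞) : (ι → κ) → (ι → κ → S) → ℝ≥0∞ :=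
  sumOp J (expOp ν J F)

theorem measurable_sumExp (hF : ∀ i, Measurable (F i)) (i : ι → κ) :
    Measurable (sumExp ν J F i) := measurable_sumOp (measurable_expOp hF) i

theorem sumExp_union (hF : ∀ i, Measurable (F i)) (h : Disjoint J K) :
    sumExp ν (J ∪ K) F = sumExp ν J (sumExp ν K F) := by
  simp only [sumExp]
  rw [sumOp_union h, expOp_union hF h, expOp_sumOp (measurable_expOp hF)]

theorem sumExp_comm (hF : ∀ i, Measurable (F i)) (h : Disjoint J K) :
    sumExp ν J (sumExp ν K F) = sumExp ν K (sumExp ν J F) := by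
  rw [← sumExp_union hF h, Finset.union_comm, sumExp_union hF h.symm]

theorem sumExp_sumOp_comm (hF : ∀ i, Measurable (F i)) (h : Disjoint J K) :
    sumExp ν J (sumOp K F) = sumOp K (sumExp ν J F) := by
  simp only [sumExp]
  rw [expOp_sumOp hF, sumOp_comm h]

theorem sumExp_expOp_comm (hF : ∀ i, Measurable (F i)) (h : Disjoint J K) :
    sumExp ν J (expOp ν K F) = expOp ν K (sumExp ν J F) := by
  simp only [sumExp]
  rw [expOp_sumOp (measurable_expOp hF), expOp_comm hF h]

theorem sumExp_mono (h : F ≤ G) : sumExp ν J F ≤ sumExp ν J G := sumOp_mono (expOp_mono h)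

theorem sumExp_singleton (i : ι → κ) (x : ι → κ → S) :
    sumExp ν {j} F i x = ∑ k, ∫⁻ y, F (Function.update i j k) (Function.update x j y) ∂ν j := by
  simp only [sumExp, sumOp_singleton, expOp_singleton]

theorem AdaptedAt.sumExp (h : AdaptedAt j F) (hF : ∀ i, Measurable (F i)) (hj : j ∉ J) :
    AdaptedAt j (sumExp ν J F) := (h.expOp hF hj).sumOp hj

end Operators

/-! ### The one-dimensional inequalities applied to a single row -/

section RowInequalities

variable {ι κ S : Type*} [Fintype ι] [DecidableEq ι] [Fintype κ] [DecidableEq κ]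
  [MeasurableSpace S] {F : (ι → κ) → (ι → κ → S) → ℝ≥0∞} {j : ι}
  {ρ : ι → κ → Measure S} [∀ j k, IsProbabilityMeasure (ρ j k)]

theorem AdaptedAt.iIndepFun (h : AdaptedAt j F) (hF : ∀ i, Measurable (F i)) (i : ι → κ)
    (x : ι → κ → S) : iIndepFun (fun k y => F (Function.update i j k) (Function.update x j y))
      (Measure.pi (ρ j)) := by
  -- By adaptedness the `k`-th function sees only the `k`-th entry of the row, so the row may be
  -- replaced by the constant row with that value.
  have := iIndepFun_pi (μ := ρ j)
    (X := fun k s => F (Function.update i j k) (Function.update x j fun _ => s))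
    (fun k => ((hF _).comp (by fun_prop)).aemeasurable)
  convert this using 3 with k y
  apply h
  simp

theorem expOp_rpow_sumOp_singleton_le (h : AdaptedAt j F) (hF : ∀ i, Measurable (F i)) {r : ℝ}
    (hr : 1 ≤ r) (i : ι → κ) (x : ι → κ → S) :
    expOp (fun j => Measure.pi (ρ j)) {j} (fun i x => sumOp {j} F i x ^ r) i x
      ≤ 6 ^ r * sumExp (fun j => Measure.pi (ρ j)) {j} F i x ^ r
        + 2 * (2 * ENNReal.ofReal r) ^ r *
          sumExp (fun j => Measure.pi (ρ j)) {j} (fun i x => F i x ^ r) i x := by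
  simp only [expOp_singleton, sumExp_singleton, sumOp_singleton]
  exact rpow_sum_le_of_indep (fun k => (hF _).comp (by fun_prop)) (h.iIndepFun hF i x) hr

theorem sumExp_singleton_rpow_le (h : AdaptedAt j F) (hF : ∀ i, Measurable (F i)) {r : ℝ}
    (hr : 1 ≤ r) {R : ℝ≥0∞} (hR : 1 ≤ R) (hRt : R ≠ ∞) (i : ι → κ) (x : ι → κ → S) :
    sumExp (fun j => Measure.pi (ρ j)) {j} (fun i x => F i x ^ r) i x
      ≤ 10 * R * ∫⁻ y, (⨆ k, F (Function.update i j k) (Function.update x j y)) ^ r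
          ∂Measure.pi (ρ j)
        + 8 * R ^ (1 - r) * sumExp (fun j => Measure.pi (ρ j)) {j} F i x ^ r := by
  simp only [sumExp_singleton]
  exact sum_rpow_le_of_indep (fun k => (hF _).comp (by fun_prop)) (h.iIndepFun hF i x) hr hR hRt

end RowInequalities

/-! ### Moment inequality for nonnegative kernels -/

section NonnegMoments

/-- The constant in the moment inequality for nonnegative kernels of order `d`. -/
def nonnegConst : ℕ → ℕ
  | 0 => 1
  | d + 1 => 100 * 6 ^ (d + 1) * nonnegConst d ^ 2

theorem one_le_nonnegConst : ∀ d, 1 ≤ nonnegConst d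
  | 0 => le_rfl
  | d + 1 => by
    have := one_le_nonnegConst d
    exact Nat.one_le_iff_ne_zero.2 (by simp [nonnegConst]; omega)

/-- The weight `r^(dr/(r-1))` cancels `r^(dr)` exactly, and it is still only exponential in `r`
because `log r ≤ r - 1`. -/
theorem exists_young_weight {r : ℝ} (hr : 1 < r) (d : ℕ) :
    ∃ R : ℝ≥0∞, 1 ≤ R ∧ R ≠ ∞ ∧ R ≤ (3 ^ d : ℝ≥0∞) ^ r ∧
      R ^ (1 - r) * ENNReal.ofReal r ^ (d * r) ≤ 1 := by
  have hr0 : 0 < r := by linarith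
  have hr1 : 0 < r - 1 := by linarith
  refine ⟨ENNReal.ofReal (r ^ (d * r / (r - 1))), ?_, ENNReal.ofReal_ne_top, ?_, ?_⟩
  · exact ENNReal.one_le_ofReal.2 (Real.one_le_rpow hr.le (by positivity))
  · rw [show (3 : ℝ≥0∞) ^ d = ENNReal.ofReal (3 ^ d) by
      rw [ENNReal.ofReal_pow (by norm_num)]; norm_num,
      ENNReal.ofReal_rpow_of_nonneg (by positivity) hr0.le]
    apply ENNReal.ofReal_le_ofReal
    rw [Real.rpow_def_of_pos hr0]
    calc Real.exp (Real.log r * (d * r / (r - 1)))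
        ≤ Real.exp ((r - 1) * (d * r / (r - 1))) := by
          gcongr
          exact Real.log_le_sub_one_of_pos hr0
      _ = (Real.exp 1 ^ d) ^ r := by
          rw [← Real.exp_nat_mul, ← Real.exp_mul]
          congr 1
          field_simp
      _ ≤ _ := by
          gcongr
          linarith [Real.exp_one_lt_d9]
  · rw [ENNReal.ofReal_rpow_of_pos (by positivity), ENNReal.ofReal_rpow_of_pos hr0,
      ← ENNReal.ofReal_mul (by positivity), ← Real.rpow_mul hr0.le,
      ← Real.rpow_add hr0]
    rw [show d * r / (r - 1) * (1 - r) + d * r = 0 by field_simp; ring]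
    simp

/-- Bookkeeping for the induction step, justifying the recursion for `nonnegConst`: numerical
factors are absorbed into `r`-th powers, and `hρ` removes the powers of `ρ` in front of `V`. -/
theorem nonneg_const_step {r : ℝ} (hr : 1 ≤ r) (d : ℕ) (c : ℝ≥0∞) (hc : 1 ≤ c) {R : ℝ≥0∞}
    (hR : R ≤ (3 ^ (d + 1) : ℝ≥0∞) ^ r) {ρ : ℝ≥0∞} (hρ : R ^ (1 - r) * ρ ^ r * ρ ^ (d * r) ≤ 1)
    (V W : ℝ≥0∞) :
    6 ^ r * (c ^ r * V) + 2 * 2 ^ r * c ^ r * (10 * R * W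
      + 2 ^ d * (ρ ^ (d * r) * (ρ ^ r * (8 * R ^ (1 - r) * (c ^ r * V)))))
      ≤ (100 * 6 ^ (d + 1) * c ^ 2) ^ r * (V + W) := by
  have hr0 : 0 ≤ r := by linarith
  have hle : ∀ x : ℝ≥0∞, 1 ≤ x → x ≤ x ^ r := fun x hx => by
    simpa using ENNReal.rpow_le_rpow_of_exponent_le hx hr
  have h2d : (1 : ℝ≥0∞) ≤ 2 ^ d := one_le_pow₀ (by norm_num)
  have hcc : c ≤ c ^ 2 := by
    rw [sq]; nth_rewrite 1 [← one_mul c]; gcongr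
  have hV : 6 ^ r * c ^ r + 2 * 2 ^ r * c ^ r * (2 ^ d * (8 * c ^ r))
      ≤ (100 * 6 ^ (d + 1) * c ^ 2) ^ r := by
    calc _ ≤ 6 ^ r * c ^ r + (2 : ℝ≥0∞) ^ r * 2 ^ r * c ^ r * ((2 ^ d) ^ r * (8 ^ r * c ^ r)) := by
          gcongr
          · exact hle _ (by norm_num)
          · exact hle _ h2d
          · exact hle _ (by norm_num)
      _ = (6 * c) ^ r + (32 * 2 ^ d * c ^ 2) ^ r := by
          rw [sq]
          simp only [← ENNReal.mul_rpow_of_nonneg _ _ hr0]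
          ring_nf
      _ ≤ (6 * c + 32 * 2 ^ d * c ^ 2) ^ r := ENNReal.add_rpow_le_rpow_add _ _ hr
      _ ≤ (6 * 6 ^ d * c ^ 2 + 32 * 6 ^ d * c ^ 2) ^ r := by
          gcongr
          · nth_rewrite 1 [← mul_one 6]
            gcongr
            exact one_le_pow₀ (by norm_num)
          · norm_num
      _ ≤ (38 * 6 ^ (d + 1) * c ^ 2) ^ r := by
          gcongr
          rw [← add_mul, ← add_mul]
          norm_num
          gcongr
          · norm_num
          · omega
      _ ≤ _ := by gcongr; norm_num
  have hW : 2 * 2 ^ r * c ^ r * (10 * R) ≤ (100 * 6 ^ (d + 1) * c ^ 2) ^ r := by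
    calc _ ≤ (2 : ℝ≥0∞) ^ r * 2 ^ r * c ^ r * (10 ^ r * (3 ^ (d + 1)) ^ r) := by
          gcongr
          · exact hle _ (by norm_num)
          · exact hle _ (by norm_num)
      _ = (40 * 3 ^ (d + 1) * c) ^ r := by
          simp only [← ENNReal.mul_rpow_of_nonneg _ _ hr0]
          ring_nf
      _ ≤ _ := by
          gcongr
          · norm_num
          · norm_num
  calc _ = (6 ^ r * c ^ r + 2 * 2 ^ r * c ^ r * (2 ^ d * (8 * c ^ r))
            * (R ^ (1 - r) * ρ ^ r * ρ ^ (d * r))) * V + 2 * 2 ^ r * c ^ r * (10 * R) * W := by ring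
    _ ≤ (6 ^ r * c ^ r + 2 * 2 ^ r * c ^ r * (2 ^ d * (8 * c ^ r)) * 1) * V
          + 2 * 2 ^ r * c ^ r * (10 * R) * W := by gcongr
    _ ≤ _ := by
        rw [mul_one, mul_add]
        gcongr

variable {ι κ S : Type*} [Fintype ι] [DecidableEq ι] [Fintype κ] [DecidableEq κ]
  [MeasurableSpace S] {F : (ι → κ) → (ι → κ → S) → ℝ≥0∞} {j : ι}
  {ρ : ι → κ → Measure S} [∀ j k, IsProbabilityMeasure (ρ j k)]
  {ν : ι → Measure (κ → S)} [∀ j, IsProbabilityMeasure (ν j)]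

/-- `E_J max_{𝐢_J} (∑_{𝐢_K} E_K F)^r`. -/
noncomputable def maxMoment (ν : ι → Measure (κ → S)) (r : ℝ) (J K : Finset ι)
    (F : (ι → κ) → (ι → κ → S) → ℝ≥0∞) : (ι → κ) → (ι → κ → S) → ℝ≥0∞ :=
  expOp ν J fun i x => maxOp J (sumExp ν K F) i x ^ r

/-- A row that is summed outside the power is either moved into the maximum, by the one-dimensional
trade, or brought inside the power. In the second case bounding the maximum over `J` by the sum and
applying Jensen over `s \ J` gives a quantity that does not depend on `J`. -/
theorem sumExp_singleton_maxMoment_le (hν : ∀ j, ν j = Measure.pi (ρ j)) (hF : ∀ i, Measurable (F i))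
    {s J : Finset ι}
    (hj : j ∉ s) (hJ : J ⊆ s) (hFj : AdaptedAt j F) {r : ℝ} (hr : 1 ≤ r) {R : ℝ≥0∞} (hR : 1 ≤ R)
    (hRt : R ≠ ∞) (i : ι → κ) (x : ι → κ → S) :
    sumExp ν {j} (maxMoment ν r J (s \ J) F) i x
      ≤ 10 * R * maxMoment ν r (insert j J) (s \ J) F i x
        + 8 * R ^ (1 - r) * expOp ν s
          (fun i x => sumOp s (sumExp ν {j} F) i x ^ r) i x := by
  have hr0 : 0 ≤ r := by linarith
  have hjJ : j ∉ J := fun h => hj (hJ h)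
  have hdisj : Disjoint {j} J := Finset.disjoint_singleton_left.2 hjJ
  have hds : Disjoint {j} s := Finset.disjoint_singleton_left.2 hj
  set G := maxOp J (sumExp ν (s \ J) F) with hG
  have hsm : ∀ i, Measurable (sumExp ν (s \ J) F i) := measurable_sumExp hF
  have hGm : ∀ i, Measurable (G i) := measurable_maxOp hsm
  have hGa : AdaptedAt j G := (hFj.sumExp hF (by simp [hj])).maxOp hjJ
  have hGr : ∀ i, Measurable fun x => G i x ^ r := fun i => (hGm i).pow_const r
  have h1 : sumExp ν {j} (expOp ν J fun i x => G i x ^ r)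
      = expOp ν J (sumExp ν {j} fun i x => G i x ^ r) := sumExp_expOp_comm hGr hdisj
  have hQ : ∀ i, Measurable fun x : ι → κ → S =>
      maxOp (insert j J) (sumExp ν (s \ J) F) i x ^ r := fun i =>
    (measurable_maxOp hsm i).pow_const r
  have h2 : (sumExp ν {j} fun i x => G i x ^ r) ≤ fun i x =>
      10 * R * expOp ν {j} (fun i x => maxOp (insert j J) (sumExp ν (s \ J) F) i x ^ r) i x
        + 8 * R ^ (1 - r) * sumExp ν {j} G i x ^ r := by
    intro i x
    beta_reduce
    obtain rfl : ν = fun j => Measure.pi (ρ j) := funext hν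
    refine (sumExp_singleton_rpow_le hGa hGm hr hR hRt i x).trans ?_
    gcongr
    rw [expOp_singleton]
    gcongr with y
    exact iSup_maxOp_update_le hjJ i _
  have h3 : (fun i x => sumExp ν {j} G i x ^ r) ≤
      expOp ν (s \ J) fun i x => sumOp s (sumExp ν {j} F) i x ^ r := by
    intro i x
    refine le_trans ?_ (rpow_expOp_le
      (measurable_sumOp (F := sumExp ν {j} F) (measurable_sumExp hF)) hr i x)
    have e : sumExp ν {j} (sumOp J (sumExp ν (s \ J) F))
        = expOp ν (s \ J) (sumOp s (sumExp ν {j} F)) := by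
      rw [sumExp_sumOp_comm hsm hdisj, sumExp_comm hF
        (hds.mono_right Finset.sdiff_subset), sumExp, ← sumOp_union Finset.disjoint_sdiff,
        Finset.union_sdiff_of_subset hJ, expOp_sumOp (measurable_sumExp hF)]
    rw [← e]
    beta_reduce
    gcongr
    exact sumExp_mono maxOp_le_sumOp i x
  have hSm : ∀ i, Measurable fun x => sumOp s (sumExp ν {j} F) i x ^ r := fun i =>
    (measurable_sumOp (measurable_sumExp hF) i).pow_const r
  have hjm : ∀ i, Measurable (sumExp ν {j} G i) := measurable_sumExp hGm
  calc sumExp ν {j} (expOp ν J fun i x => G i x ^ r) i x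
      = expOp ν J (sumExp ν {j} fun i x => G i x ^ r) i x := by rw [h1]
    _ ≤ expOp ν J (fun i x => 10 * R * expOp ν {j}
          (fun i x => maxOp (insert j J) (sumExp ν (s \ J) F) i x ^ r) i x
        + 8 * R ^ (1 - r) * sumExp ν {j} G i x ^ r) i x := expOp_mono h2 i x
    _ = 10 * R * expOp ν J (expOp ν {j}
          (fun i x => maxOp (insert j J) (sumExp ν (s \ J) F) i x ^ r)) i x
        + 8 * R ^ (1 - r) * expOp ν J (fun i x => sumExp ν {j} G i x ^ r) i x := by
        rw [expOp_add (fun i => (measurable_expOp hQ i).const_mul _),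
          expOp_const_mul (measurable_expOp hQ),
          expOp_const_mul (fun i => (hjm i).pow_const r)]
    _ ≤ _ := by
        gcongr
        · refine le_of_eq ?_
          rw [maxMoment, ← expOp_union hQ hdisj.symm, Finset.union_comm, ← Finset.insert_eq]
        · refine (expOp_mono h3 i x).trans_eq ?_
          rw [← expOp_union hSm Finset.disjoint_sdiff, Finset.union_sdiff_of_subset hJ]

theorem sumOp_finsetSum {α : Type*} (t : Finset α) (c : α → ℝ≥0∞)
    (f : α → (ι → κ) → (ι → κ → S) → ℝ≥0∞) (J : Finset ι) (i : ι → κ) (x : ι → κ → S) :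
    sumOp J (fun i x => ∑ a ∈ t, c a * f a i x) i x = ∑ a ∈ t, c a * sumOp J (f a) i x := by
  simp only [sumOp]
  rw [Finset.sum_comm]
  simp only [Finset.mul_sum]

theorem expOp_finsetSum {α : Type*} (t : Finset α) (c : α → ℝ≥0∞)
    (f : α → (ι → κ) → (ι → κ → S) → ℝ≥0∞) (hf : ∀ a i, Measurable (f a i)) (J : Finset ι) :
    expOp ν J (fun i x => ∑ a ∈ t, c a * f a i x)
      = fun i x => ∑ a ∈ t, c a * expOp ν J (f a) i x := by
  ext i x
  simp only [expOp, lmarginal]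
  have h : ∀ a, Measurable fun y => f a i (Function.updateFinset x J y) := fun a =>
    (hf a i).comp measurable_updateFinset
  rw [lintegral_finsetSum _ (fun a _ => (h a).const_mul _)]
  refine Finset.sum_congr rfl fun a _ => ?_
  rw [lintegral_const_mul _ (h a)]

theorem measurable_maxMoment (hF : ∀ i, Measurable (F i)) (r : ℝ) (J K : Finset ι) (i : ι → κ) :
    Measurable (maxMoment ν r J K F i) :=
  measurable_expOp (fun i => (measurable_maxOp (measurable_sumExp hF) i).pow_const r) i

/-- Induction on the set of rows, for all kernels simultaneously. For a new row `j`, Rosenthal gives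
two terms. In the first, row `j` is summed and averaged inside the power, and the induction
hypothesis for `sumExp ν {j} F` yields the sets `J` without `j`. In the second it is summed outside;
the hypothesis for `F` and the trade of row `j` for a maximum yield the sets containing `j`, plus a
multiple of the first term. -/
theorem expOp_rpow_sumOp_le (hν : ∀ j, ν j = Measure.pi (ρ j)) {r : ℝ} (hr : 1 < r) (s : Finset ι) :
    ∀ {F : (ι → κ) → (ι → κ → S) → ℝ≥0∞}, (∀ i, Measurable (F i)) → (∀ j ∈ s, AdaptedAt j F) →
      ∀ (i : ι → κ) (x : ι → κ → S),
      expOp ν s (fun i x => sumOp s F i x ^ r) i x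
        ≤ (nonnegConst s.card : ℝ≥0∞) ^ r * ∑ J ∈ s.powerset,
          ENNReal.ofReal r ^ (J.card * r) *
            maxMoment ν r J (s \ J) F i x := by
  have hr0 : 0 ≤ r := by linarith
  have hq1 : 1 ≤ ENNReal.ofReal r := ENNReal.one_le_ofReal.2 hr.le
  generalize hq : ENNReal.ofReal r = q at hq1
  induction s using Finset.induction_on with
  | empty =>
    intro F hF hFa i x
    simp [expOp_empty, sumOp_empty, maxMoment, maxOp_empty, sumExp, nonnegConst]
  | insert j s hj ih =>
    intro F hF hFa i x
    -- Row `j` contributes one factor `r^r` through Rosenthal, and the weights of the sets `J`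
    -- contribute at most `r^(s.card * r)`; hence the exponent `s.card + 1`.
    obtain ⟨R, hR, hRt, hRle, hRρ⟩ := exists_young_weight hr (s.card + 1)
    rw [hq] at hRρ
    have hds : Disjoint {j} s := Finset.disjoint_singleton_left.2 hj
    have hPm : ∀ i, Measurable (sumExp ν {j} F i) := measurable_sumExp hF
    have hsm : ∀ i, Measurable (sumOp s F i) := measurable_sumOp hF
    have hsr : ∀ i, Measurable fun x => sumOp s F i x ^ r := fun i => (hsm i).pow_const r
    obtain ⟨c, hc⟩ : ∃ c : ℝ≥0∞, c = nonnegConst s.card := ⟨_, rfl⟩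
    rw [← hc] at ih
    obtain ⟨V, hV⟩ : ∃ V, V = ∑ J ∈ s.powerset,
      q ^ (J.card * r) * maxMoment ν r J (insert j s \ J) F i x := ⟨_, rfl⟩
    obtain ⟨W, hW⟩ : ∃ W, W = ∑ J ∈ s.powerset, q ^ (((insert j J).card : ℝ) * r) *
      maxMoment ν r (insert j J) (insert j s \ insert j J) F i x := ⟨_, rfl⟩
    have hsplit : ∑ J ∈ (insert j s).powerset,
        q ^ (J.card * r) * maxMoment ν r J (insert j s \ J) F i x = V + W := by
      rw [hV, hW]
      exact Finset.sum_powerset_insert hj _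
    have hP : expOp ν s (fun i x => sumOp s (sumExp ν {j} F) i x ^ r) i x ≤ c ^ r * V := by
      have hPa : ∀ J ∈ s.powerset, maxMoment ν r J (s \ J) (sumExp ν {j} F)
          = maxMoment ν r J (insert j s \ J) F := by
        intro J hJ
        have hJs := Finset.mem_powerset.1 hJ
        rw [maxMoment, maxMoment, ← sumExp_union hF
          (hds.mono_right Finset.sdiff_subset).symm, Finset.union_comm, ← Finset.insert_eq,
          Finset.insert_sdiff_of_notMem _ fun h => hj (hJs h)]
      have hPV : ∑ J ∈ s.powerset, q ^ (J.card * r) *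
          maxMoment ν r J (s \ J) (sumExp ν {j} F) i x = V := by
        rw [hV]
        exact Finset.sum_congr rfl fun J hJ => by rw [hPa J hJ]
      rw [← hPV]
      exact ih hPm (fun j' hj' => (hFa j' (Finset.mem_insert_of_mem hj')).sumExp hF
        (by rintro h; exact hj (Finset.mem_singleton.1 h ▸ hj'))) i x
    have hFj := hFa j (Finset.mem_insert_self j s)
    have hMm : ∀ J i, Measurable (maxMoment ν r J (s \ J) F i) := fun J =>
      measurable_maxMoment hF r J (s \ J)
    obtain ⟨W₀, hW₀⟩ : ∃ W₀, W₀ = ∑ J ∈ s.powerset, q ^ (J.card * r) *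
      maxMoment ν r (insert j J) (s \ J) F i x := ⟨_, rfl⟩
    -- The Rosenthal factor `q ^ r` is exactly what raises the weight from `J.card` to `J.card + 1`.
    have hWW : W = q ^ r * W₀ := by
      rw [hW, hW₀, Finset.mul_sum]
      refine Finset.sum_congr rfl fun J hJ => ?_
      have hJs := Finset.mem_powerset.1 hJ
      have hjJ : j ∉ J := fun h => hj (hJs h)
      rw [Finset.card_insert_of_notMem hjJ, ← mul_assoc, ← ENNReal.rpow_add_of_nonneg _ _ hr0
        (by positivity), Finset.insert_sdiff_insert, Finset.sdiff_insert_of_notMem hj]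
      push_cast
      ring_nf
    have hT : expOp ν s (sumExp ν {j} fun i x => sumOp s F i x ^ r) i x
        ≤ c ^ r * (10 * R * W₀ + 2 ^ s.card * (q ^ (s.card * r) *
          (8 * R ^ (1 - r) * (c ^ r * V)))) := by
      rw [← sumExp_expOp_comm hsr hds]
      calc sumExp ν {j} (expOp ν s fun i x => sumOp s F i x ^ r) i x
          ≤ sumExp ν {j} (fun i x => ∑ J ∈ s.powerset,
              (c ^ r * q ^ (J.card * r)) * maxMoment ν r J (s \ J) F i x) i x := by
            refine sumExp_mono (fun i x => ?_) i x
            refine (ih hF (fun j' hj' => hFa j' (Finset.mem_insert_of_mem hj')) i x).trans_eq ?_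
            simp only [Finset.mul_sum, mul_assoc]
        _ = ∑ J ∈ s.powerset, (c ^ r * q ^ (J.card * r)) *
              sumExp ν {j} (maxMoment ν r J (s \ J) F) i x := by
            rw [sumExp, expOp_finsetSum _ _ _ hMm, sumOp_finsetSum]
            rfl
        _ ≤ ∑ J ∈ s.powerset, (c ^ r * q ^ (J.card * r)) *
              (10 * R * maxMoment ν r (insert j J) (s \ J) F i x
                + 8 * R ^ (1 - r) * (c ^ r * V)) := by
            refine Finset.sum_le_sum fun J hJ => ?_
            gcongr
            refine (sumExp_singleton_maxMoment_le hν hF hj (Finset.mem_powerset.1 hJ) hFj hr.le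
              hR hRt i x).trans ?_
            gcongr
        _ = c ^ r * (10 * R * W₀ + (∑ J ∈ s.powerset, q ^ (J.card * r)) *
              (8 * R ^ (1 - r) * (c ^ r * V))) := by
            rw [hW₀, Finset.mul_sum, Finset.sum_mul, ← Finset.sum_add_distrib, Finset.mul_sum]
            exact Finset.sum_congr rfl fun J _ => by ring
        _ ≤ _ := by
            rw [← mul_assoc (2 ^ s.card)]
            gcongr
            calc _ ≤ ∑ _J ∈ s.powerset, q ^ (s.card * r) := by
                  refine Finset.sum_le_sum fun J hJ => ?_
                  refine ENNReal.rpow_le_rpow_of_exponent_le hq1 ?_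
                  have := Finset.card_le_card (Finset.mem_powerset.1 hJ)
                  gcongr
              _ = _ := by simp
    rw [hsplit]
    have hN : expOp ν {j} (fun i x => sumOp {j} (sumOp s F) i x ^ r) ≤ fun i x =>
        6 ^ r * sumExp ν {j} (sumOp s F) i x ^ r
          + 2 * (2 * q) ^ r * sumExp ν {j} (fun i x => sumOp s F i x ^ r) i x := by
      obtain rfl : ν = fun j => Measure.pi (ρ j) := funext hν
      rw [← hq]
      exact fun i x => expOp_rpow_sumOp_singleton_le (hFj.sumOp hj) hsm hr.le i x
    have hjm : ∀ i, Measurable (sumExp ν {j} (sumOp s F) i) := measurable_sumExp hsm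
    have hAm : ∀ i, Measurable fun x => sumOp {j} (sumOp s F) i x ^ r := fun i =>
      (measurable_sumOp hsm i).pow_const r
    calc expOp ν (insert j s) (fun i x => sumOp (insert j s) F i x ^ r) i x
        = expOp ν s (expOp ν {j} fun i x => sumOp {j} (sumOp s F) i x ^ r) i x := by
          rw [sumOp_insert_left hj, Finset.insert_eq, Finset.union_comm, expOp_union hAm hds.symm]
      _ ≤ expOp ν s (fun i x => 6 ^ r * sumExp ν {j} (sumOp s F) i x ^ r
          + 2 * (2 * q) ^ r * sumExp ν {j} (fun i x => sumOp s F i x ^ r) i x) i x :=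
          expOp_mono hN i x
      _ = 6 ^ r * expOp ν s (fun i x => sumOp s (sumExp ν {j} F) i x ^ r) i x
          + 2 * (2 * q) ^ r *
            expOp ν s (sumExp ν {j} fun i x => sumOp s F i x ^ r) i x := by
          rw [expOp_add (fun i => ((hjm i).pow_const r).const_mul _),
            expOp_const_mul (fun i => (hjm i).pow_const r),
            expOp_const_mul (measurable_sumExp hsr), sumExp_sumOp_comm hF hds]
      _ ≤ 6 ^ r * (c ^ r * V) + 2 * (2 * q) ^ r * (c ^ r * (10 * R * W₀ + 2 ^ s.card *
            (q ^ (s.card * r) * (8 * R ^ (1 - r) * (c ^ r * V))))) := by gcongr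
      _ = 6 ^ r * (c ^ r * V) + 2 * 2 ^ r * c ^ r * (10 * R * W
            + 2 ^ s.card * (q ^ (s.card * r) * (q ^ r * (8 * R ^ (1 - r) * (c ^ r * V))))) := by
          rw [hWW, ENNReal.mul_rpow_of_nonneg _ _ hr0]
          ring
      _ ≤ (100 * 6 ^ (s.card + 1) * c ^ 2) ^ r * (V + W) := by
          refine nonneg_const_step hr.le s.card c ?_ hRle ?_ V W
          · rw [hc]
            exact_mod_cast one_le_nonnegConst s.card
          · refine le_of_eq_of_le ?_ hRρ
            rw [mul_assoc, ← ENNReal.rpow_add_of_nonneg _ _ hr0 (by positivity)]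
            push_cast
            ring_nf
      _ = _ := by
          rw [Finset.card_insert_of_notMem hj, nonnegConst]
          push_cast
          rw [← hc]

end NonnegMoments

/-! ### Inserting signs into canonical sums -/

section Centered

/-- Jensen's inequality in `B` for each fixed value of `A`, the joint law being a product. -/
theorem lintegral_enorm_rpow_le_of_indep_centered {Ω : Type*} [MeasurableSpace Ω] {μ : Measure Ω}
    [IsProbabilityMeasure μ] {A B : Ω → ℝ} (hA : Measurable A) (hB : Measurable B)
    (hAB : IndepFun A B μ) (hBi : Integrable B μ) (hB0 : ∫ ω, B ω ∂μ = 0) {p : ℝ} (hp : 1 ≤ p) :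
    ∫⁻ ω, ‖A ω‖ₑ ^ p ∂μ ≤ ∫⁻ ω, ‖A ω + B ω‖ₑ ^ p ∂μ := by
  have hlaw := (indepFun_iff_map_prod_eq_prod_map_map hA.aemeasurable hB.aemeasurable).1 hAB
  have : IsProbabilityMeasure (μ.map B) := Measure.isProbabilityMeasure_map hB.aemeasurable
  have hm : Measurable fun z : ℝ × ℝ => ‖z.1 + z.2‖ₑ ^ p := by fun_prop
  calc ∫⁻ ω, ‖A ω‖ₑ ^ p ∂μ = ∫⁻ a, ‖a‖ₑ ^ p ∂μ.map A := by
        rw [lintegral_map (by fun_prop) hA]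
    _ ≤ ∫⁻ a, ∫⁻ b, ‖a + b‖ₑ ^ p ∂μ.map B ∂μ.map A := by
        refine lintegral_mono fun a => ?_
        have hbi : Integrable (fun b : ℝ => b) (μ.map B) :=
          (integrable_map_measure (by fun_prop) hB.aemeasurable).2 hBi
        have h1 : ∫ b, (a + b) ∂μ.map B = a := by
          have hb0 : ∫ b, b ∂μ.map B = 0 := by
            rw [integral_map hB.aemeasurable (by fun_prop), hB0]
          rw [integral_add (integrable_const a) hbi, hb0]
          simp
        calc ‖a‖ₑ ^ p = ‖∫ b, (a + b) ∂μ.map B‖ₑ ^ p := by rw [h1]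
          _ ≤ (∫⁻ b, ‖a + b‖ₑ ∂μ.map B) ^ p := by
              gcongr
              exact enorm_integral_le_lintegral_enorm _
          _ ≤ _ := rpow_lintegral_le (by fun_prop) hp
    _ = ∫⁻ z, ‖z.1 + z.2‖ₑ ^ p ∂(μ.map A).prod (μ.map B) := by
        rw [lintegral_prod _ hm.aemeasurable]
    _ = _ := by
        rw [← hlaw, lintegral_map hm (by fun_prop)]

/-- The sign `±1` encoded by a Boolean. -/
def sgn (b : Bool) : ℝ := if b then 1 else -1

theorem sgn_mul_self (b : Bool) : sgn b * sgn b = 1 := by cases b <;> simp [sgn]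

theorem measurable_sgn : Measurable sgn := measurable_of_countable _

/-- The signed sum is the difference of two partial sums, and each partial sum has a smaller moment
than the full sum because the missing part is independent and centered. -/
theorem lintegral_enorm_signed_sum_rpow_le {Ω κ : Type*} [Fintype κ] [DecidableEq κ]
    [MeasurableSpace Ω] {μ : Measure Ω} [IsProbabilityMeasure μ] {Y : κ → Ω → ℝ}
    (hY : ∀ k, Measurable (Y k)) (hind : iIndepFun Y μ) (hYi : ∀ k, Integrable (Y k) μ)
    (hY0 : ∀ k, ∫ ω, Y k ω ∂μ = 0) (ε : κ → Bool) {p : ℝ} (hp : 1 ≤ p) :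
    ∫⁻ ω, ‖∑ k, sgn (ε k) * Y k ω‖ₑ ^ p ∂μ ≤ 2 ^ p * ∫⁻ ω, ‖∑ k, Y k ω‖ₑ ^ p ∂μ := by
  have hpart : ∀ T : Finset κ, ∫⁻ ω, ‖∑ k ∈ T, Y k ω‖ₑ ^ p ∂μ ≤ ∫⁻ ω, ‖∑ k, Y k ω‖ₑ ^ p ∂μ := by
    intro T
    have hI := hind.indepFun_finset T Tᶜ disjoint_compl_right hY
    have hI' : IndepFun (fun ω => ∑ k ∈ T, Y k ω) (fun ω => ∑ k ∈ Tᶜ, Y k ω) μ := by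
      have := hI.comp (φ := fun z => ∑ k, z k) (ψ := fun z => ∑ k, z k) (by fun_prop) (by fun_prop)
      convert this using 1
      · ext ω; exact (Finset.sum_coe_sort T fun k => Y k ω).symm
      · ext ω; exact (Finset.sum_coe_sort Tᶜ fun k => Y k ω).symm
    refine (lintegral_enorm_rpow_le_of_indep_centered (by fun_prop) (by fun_prop) hI'
      (integrable_finsetSum _ fun k _ => hYi k) ?_ hp).trans_eq ?_
    · rw [integral_finsetSum _ fun k _ => hYi k]
      exact Finset.sum_eq_zero fun k _ => hY0 k
    · simp only [Finset.sum_add_sum_compl]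
  set T : Finset κ := Finset.univ.filter fun k => ε k = true with hT
  have hsplit : ∀ ω, ∑ k, sgn (ε k) * Y k ω = ∑ k ∈ T, Y k ω - ∑ k ∈ Tᶜ, Y k ω := by
    intro ω
    rw [← Finset.sum_add_sum_compl T, sub_eq_add_neg, ← Finset.sum_neg_distrib]
    congr 1
    · refine Finset.sum_congr rfl fun k hk => ?_
      rw [hT, Finset.mem_filter] at hk
      simp [sgn, hk.2]
    · refine Finset.sum_congr rfl fun k hk => ?_
      simp only [hT, Finset.mem_compl, Finset.mem_filter, Finset.mem_univ, true_and,
        Bool.not_eq_true] at hk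
      simp [sgn, hk]
  calc ∫⁻ ω, ‖∑ k, sgn (ε k) * Y k ω‖ₑ ^ p ∂μ
      ≤ ∫⁻ ω, 2 ^ (p - 1) * (‖∑ k ∈ T, Y k ω‖ₑ ^ p + ‖∑ k ∈ Tᶜ, Y k ω‖ₑ ^ p) ∂μ := by
        refine lintegral_mono fun ω => ?_
        rw [hsplit]
        refine le_trans ?_ (ENNReal.rpow_add_le_mul_rpow_add_rpow _ _ hp)
        gcongr
        exact enorm_sub_le
    _ ≤ 2 ^ (p - 1) * (∫⁻ ω, ‖∑ k, Y k ω‖ₑ ^ p ∂μ + ∫⁻ ω, ‖∑ k, Y k ω‖ₑ ^ p ∂μ) := by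
        rw [lintegral_const_mul _ (by fun_prop), lintegral_add_left (by fun_prop)]
        exact mul_le_mul' le_rfl (add_le_add (hpart T) (hpart Tᶜ))
    _ = _ := by
        rw [← two_mul, ← mul_assoc]
        congr 1
        nth_rewrite 2 [← ENNReal.rpow_one 2]
        rw [← ENNReal.rpow_add_of_nonneg _ _ (by linarith) zero_le_one, sub_add_cancel]

variable {ι κ S : Type*} [Fintype ι] [DecidableEq ι] [Fintype κ] [DecidableEq κ]
  [MeasurableSpace S]

theorem lintegral_lmarginal {T : Type*} [MeasurableSpace T] {ν : ι → Measure T}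
    [∀ j, IsProbabilityMeasure (ν j)] (J : Finset ι) {f : (ι → T) → ℝ≥0∞} (hf : Measurable f) :
    ∫⁻ x, (∫⋯∫⁻_J, f ∂ν) x ∂Measure.pi ν = ∫⁻ x, f x ∂Measure.pi ν := by
  refine lintegral_eq_of_lmarginal_eq J (hf.lmarginal ν) hf ?_
  ext x
  have : ∀ y, (∫⋯∫⁻_J, f ∂ν) (Function.updateFinset x J y) = (∫⋯∫⁻_J, f ∂ν) x := fun y =>
    lmarginal_congr ν f fun j hj => by simp [Function.updateFinset, hj]
  rw [lmarginal]
  simp [this]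

theorem lintegral_update {T : Type*} [MeasurableSpace T] {ν : ι → Measure T}
    [∀ j, IsProbabilityMeasure (ν j)] (j : ι) {f : (ι → T) → ℝ≥0∞} (hf : Measurable f) :
    ∫⁻ x, ∫⁻ y, f (Function.update x j y) ∂ν j ∂Measure.pi ν = ∫⁻ x, f x ∂Measure.pi ν := by
  rw [← lintegral_lmarginal {j} hf, lmarginal_singleton]

/-- A canonical family of kernels: `H i` depends on the entries `x j (i j)` only, is integrable, and
is centered in each row. -/
structure CanonicalFamily (ν : ι → Measure (κ → S)) (H : (ι → κ) → (ι → κ → S) → ℝ) : Prop where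
  measurable : ∀ i, Measurable (H i)
  integrable : ∀ i, Integrable (H i) (Measure.pi ν)
  adapted : ∀ i j x y y', y (i j) = y' (i j) →
    H i (Function.update x j y) = H i (Function.update x j y')
  centered : ∀ i j, ∀ᵐ x ∂Measure.pi ν, ∫ y, H i (Function.update x j y) ∂ν j = 0

theorem CanonicalFamily.const_mul {ν : ι → Measure (κ → S)} {H : (ι → κ) → (ι → κ → S) → ℝ}
    (hH : CanonicalFamily ν H) (c : (ι → κ) → ℝ) : CanonicalFamily ν fun i x => c i * H i x where
  measurable i := (hH.measurable i).const_mul _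
  integrable i := (hH.integrable i).const_mul _
  adapted i j x y y' h := by rw [hH.adapted i j x y y' h]
  centered i j := by
    filter_upwards [hH.centered i j] with x hx
    rw [integral_const_mul, hx, mul_zero]

variable {ρ : ι → κ → Measure S} [∀ j k, IsProbabilityMeasure (ρ j k)]
  {H : (ι → κ) → (ι → κ → S) → ℝ}

/-- With the other rows frozen, the kernels grouped by the value of `i j` are independent and
centered functions of row `j`, for almost every choice of the frozen rows. -/
theorem CanonicalFamily.lintegral_sgn_row_le
    (hH : CanonicalFamily (fun j => Measure.pi (ρ j)) H) (j : ι) (ε : κ → Bool) {p : ℝ}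
    (hp : 1 ≤ p) :
    ∫⁻ x, ‖∑ i, sgn (ε (i j)) * H i x‖ₑ ^ p ∂Measure.pi (fun j => Measure.pi (ρ j))
      ≤ 2 ^ p * ∫⁻ x, ‖∑ i, H i x‖ₑ ^ p ∂Measure.pi (fun j => Measure.pi (ρ j)) := by
  have hHm := hH.measurable
  have hf : Measurable fun x => ‖∑ i, sgn (ε (i j)) * H i x‖ₑ ^ p := by fun_prop
  have hg : Measurable fun x => ‖∑ i, H i x‖ₑ ^ p := by fun_prop
  have hg' : Measurable fun z : (ι → κ → S) × (κ → S) =>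
    ‖∑ i, H i (Function.update z.1 j z.2)‖ₑ ^ p := hg.comp measurable_update'
  rw [← lintegral_update j hf, ← lintegral_update j hg,
    ← lintegral_const_mul _ hg'.lintegral_prod_right]
  have hint : ∀ᵐ x ∂Measure.pi (fun j => Measure.pi (ρ j)), ∀ i,
      Integrable (fun y => H i (Function.update x j y)) (Measure.pi (ρ j)) := by
    rw [ae_all_iff]
    intro i
    have h1 := (hH.integrable i).2
    have h2 : Measurable fun z : (ι → κ → S) × (κ → S) =>
      ‖H i (Function.update z.1 j z.2)‖ₑ := (hHm i).enorm.comp measurable_update'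
    rw [HasFiniteIntegral, ← lintegral_update j (hHm i).enorm] at h1
    filter_upwards [ae_lt_top h2.lintegral_prod_right h1.ne] with x hx
    exact ⟨((hHm i).comp (by fun_prop)).aestronglyMeasurable, hx⟩
  have hcen : ∀ᵐ x ∂Measure.pi (fun j => Measure.pi (ρ j)), ∀ i,
      ∫ y, H i (Function.update x j y) ∂Measure.pi (ρ j) = 0 :=
    ae_all_iff.2 fun i => hH.centered i j
  refine lintegral_mono_ae ?_
  filter_upwards [hint, hcen] with x hxi hxc
  set Y : κ → (κ → S) → ℝ := fun k y =>
    ∑ i with i j = k, H i (Function.update x j y) with hY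
  have hYm : ∀ k, Measurable (Y k) := fun k => by
    refine Finset.measurable_sum _ fun i _ => (hHm i).comp (by fun_prop)
  have hYind : iIndepFun Y (Measure.pi (ρ j)) := by
    have := iIndepFun_pi (μ := ρ j)
      (X := fun k s => Y k fun _ => s) (fun k => ((hYm k).comp (by fun_prop)).aemeasurable)
    convert this using 2 with k
    ext y
    refine Finset.sum_congr rfl fun i hi => hH.adapted i j x _ _ ?_
    rw [(Finset.mem_filter.1 hi).2]
  have e : ∀ (c : κ → ℝ) y, ∑ i, c (i j) * H i (Function.update x j y) = ∑ k, c k * Y k y := by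
    intro c y
    rw [← Finset.sum_fiberwise Finset.univ (fun i : ι → κ => i j)]
    refine Finset.sum_congr rfl fun k _ => ?_
    rw [hY, Finset.mul_sum]
    refine Finset.sum_congr rfl fun i hi => ?_
    rw [(Finset.mem_filter.1 hi).2]
  have e1 : ∀ y, ∑ i, H i (Function.update x j y) = ∑ k, Y k y := fun y => by
    simpa using e (fun _ => 1) y
  simp only [e fun k => sgn (ε k), e1]
  refine lintegral_enorm_signed_sum_rpow_le hYm hYind
    (fun k => integrable_finsetSum _ fun i _ => hxi i) (fun k => ?_) ε hp
  rw [hY, integral_finsetSum _ fun i _ => hxi i]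
  exact Finset.sum_eq_zero fun i _ => hxc i

/-- The product of the signs picked out by the multi-index `i`, over the rows in `J`. -/
def sgnProd (J : Finset ι) (ε : ι → κ → Bool) (i : ι → κ) : ℝ := ∏ j ∈ J, sgn (ε j (i j))

theorem sgnProd_mul_self (J : Finset ι) (ε : ι → κ → Bool) (i : ι → κ) :
    sgnProd J ε i * sgnProd J ε i = 1 := by
  rw [sgnProd, ← Finset.prod_mul_distrib]
  exact Finset.prod_eq_one fun j _ => sgn_mul_self _

theorem measurable_sgnProd (J : Finset ι) (i : ι → κ) :
    Measurable fun ε : ι → κ → Bool => sgnProd J ε i := by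
  unfold sgnProd
  exact Finset.measurable_prod _ fun j _ => measurable_sgn.comp (by fun_prop)

theorem CanonicalFamily.lintegral_sgnProd_le
    (hH : CanonicalFamily (fun j => Measure.pi (ρ j)) H) (J : Finset ι) (ε : ι → κ → Bool) {p : ℝ}
    (hp : 1 ≤ p) :
    ∫⁻ x, ‖∑ i, sgnProd J ε i * H i x‖ₑ ^ p ∂Measure.pi (fun j => Measure.pi (ρ j))
      ≤ (2 ^ p) ^ J.card *
        ∫⁻ x, ‖∑ i, H i x‖ₑ ^ p ∂Measure.pi (fun j => Measure.pi (ρ j)) := by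
  induction J using Finset.induction_on with
  | empty => simp [sgnProd]
  | insert j J hj ih =>
    have := (hH.const_mul (sgnProd J ε)).lintegral_sgn_row_le j (ε j) hp
    simp only [← mul_assoc] at this
    simp only [sgnProd, Finset.prod_insert hj, Finset.card_insert_of_notMem hj] at this ih ⊢
    rw [pow_succ', mul_assoc]
    exact this.trans (by gcongr)

/-- The signed family is again canonical, and multiplying twice by the same signs does nothing. -/
theorem CanonicalFamily.lintegral_le_sgnProd
    (hH : CanonicalFamily (fun j => Measure.pi (ρ j)) H) (J : Finset ι) (ε : ι → κ → Bool) {p : ℝ}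
    (hp : 1 ≤ p) :
    ∫⁻ x, ‖∑ i, H i x‖ₑ ^ p ∂Measure.pi (fun j => Measure.pi (ρ j))
      ≤ (2 ^ p) ^ J.card *
        ∫⁻ x, ‖∑ i, sgnProd J ε i * H i x‖ₑ ^ p ∂Measure.pi (fun j => Measure.pi (ρ j)) := by
  have := (hH.const_mul (sgnProd J ε)).lintegral_sgnProd_le J ε hp
  simpa only [← mul_assoc, sgnProd_mul_self, one_mul] using this

end Centered

/-! ### Khinchine's inequality with constant of order `√p` -/

section Khinchine

theorem rpow_abs_le_exp_add_exp {p l : ℝ} (hp : 0 < p) (hl : 0 < l) (x : ℝ) :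
    |x| ^ p ≤ (p / l) ^ p * Real.exp (-p) * (Real.exp (l * x) + Real.exp (-l * x)) := by
  -- This is `u ≤ exp (u - 1)` at `u = l|x|/p`.
  have h1 : |x| ≤ p / l * Real.exp (l * |x| / p - 1) := by
    have := Real.add_one_le_exp (l * |x| / p - 1)
    calc |x| = p / l * (l * |x| / p - 1 + 1) := by field_simp; ring
      _ ≤ _ := by gcongr
  calc |x| ^ p ≤ (p / l * Real.exp (l * |x| / p - 1)) ^ p := by gcongr
    _ = (p / l) ^ p * Real.exp (-p) * Real.exp (l * |x|) := by
        rw [Real.mul_rpow (by positivity) (Real.exp_nonneg _), ← Real.exp_mul, mul_assoc,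
          ← Real.exp_add]
        congr 2
        field_simp
        ring
    _ ≤ _ := by
        gcongr
        rcases abs_cases x with ⟨h, _⟩ | ⟨h, _⟩ <;> rw [h]
        · linarith [Real.exp_nonneg (-l * x)]
        · rw [mul_neg, ← neg_mul]
          linarith [Real.exp_nonneg (l * x)]

theorem lintegral_enorm_rpow_le_of_subgaussian {Ω : Type*} [MeasurableSpace Ω] {μ : Measure Ω}
    {X : Ω → ℝ} {c : NNReal} (h : HasSubgaussianMGF X c μ) {p : ℝ} (hp : 1 ≤ p) :
    ∫⁻ ω, ‖X ω‖ₑ ^ p ∂μ ≤ (4 * ENNReal.ofReal p * c) ^ (p / 2) := by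
  have hp0 : 0 < p := by linarith
  rcases eq_or_ne c 0 with rfl | hc
  · have := h.ae_eq_zero_of_hasSubgaussianMGF_zero
    have h0 : ∫⁻ ω, ‖X ω‖ₑ ^ p ∂μ = 0 := by
      rw [lintegral_congr_ae (g := fun _ => 0)]
      · simp
      · filter_upwards [this] with ω hω
        simp [hω, hp0]
    rw [h0]
    exact zero_le
  have hc0 : (0 : ℝ) < c := by exact_mod_cast pos_iff_ne_zero.2 hc
  -- Minimizes `l^(-p) exp (c l^2 / 2)`.
  set l : ℝ := Real.sqrt (p / c) with hl
  have hl0 : 0 < l := by positivity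
  have hl2 : l ^ 2 = p / c := Real.sq_sqrt (by positivity)
  set C : ℝ := (p / l) ^ p * Real.exp (-p) with hC
  have hC0 : 0 ≤ C := by positivity
  have hint : Integrable (fun ω => C * (Real.exp (l * X ω) + Real.exp (-l * X ω))) μ :=
    ((h.integrable_exp_mul l).add (h.integrable_exp_mul (-l))).const_mul C
  calc ∫⁻ ω, ‖X ω‖ₑ ^ p ∂μ
      ≤ ∫⁻ ω, ENNReal.ofReal (C * (Real.exp (l * X ω) + Real.exp (-l * X ω))) ∂μ := by
        refine lintegral_mono fun ω => ?_
        rw [Real.enorm_eq_ofReal_abs, ENNReal.ofReal_rpow_of_nonneg (abs_nonneg _) hp0.le]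
        exact ENNReal.ofReal_le_ofReal (rpow_abs_le_exp_add_exp hp0 hl0 _)
    _ = ENNReal.ofReal (C * (mgf X μ l + mgf X μ (-l))) := by
        rw [← ofReal_integral_eq_lintegral_ofReal hint]
        · rw [integral_const_mul, integral_add (h.integrable_exp_mul l)
            (h.integrable_exp_mul (-l))]
          rfl
        · exact Filter.Eventually.of_forall fun ω => by dsimp only; positivity
    _ ≤ ENNReal.ofReal ((4 * p * c) ^ (p / 2)) := by
        apply ENNReal.ofReal_le_ofReal
        have e1 : (c : ℝ) * l ^ 2 / 2 = p / 2 := by rw [hl2]; field_simp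
        have e2 : (c : ℝ) * (-l) ^ 2 / 2 = p / 2 := by rw [neg_sq, e1]
        have m1 := h.mgf_le l
        have m2 := h.mgf_le (-l)
        rw [e1] at m1
        rw [e2] at m2
        have e3 : (p / l) ^ p = (p * c) ^ (p / 2) := by
          rw [show p = 2 * (p / 2) by ring, Real.rpow_mul (by positivity), ← show p = 2 * (p / 2) by
            ring, Real.rpow_two, div_pow, hl2]
          congr 1
          field_simp
        calc C * (mgf X μ l + mgf X μ (-l)) ≤ C * (Real.exp (p / 2) + Real.exp (p / 2)) := by
              gcongr
          _ = (p * c) ^ (p / 2) * (2 * (Real.exp (-p) * Real.exp (p / 2))) := by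
              rw [hC, e3]; ring
          _ ≤ (p * c) ^ (p / 2) * 4 ^ (p / 2) := by
              gcongr
              rw [← Real.exp_add]
              have : Real.exp (-p + p / 2) ≤ 1 := Real.exp_le_one_iff.2 (by linarith)
              have h4 : (2 : ℝ) ≤ 4 ^ (p / 2) := by
                rw [show (4 : ℝ) = 2 ^ (2 : ℝ) by norm_num, ← Real.rpow_mul (by norm_num)]
                nth_rewrite 1 [← Real.rpow_one 2]
                exact Real.rpow_le_rpow_of_exponent_le (by norm_num) (by linarith)
              linarith
          _ = _ := by
              rw [← Real.mul_rpow (by positivity) (by positivity)]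
              ring_nf
    _ = _ := by
        rw [← ENNReal.ofReal_rpow_of_nonneg (by positivity) (by positivity),
          ENNReal.ofReal_mul (by positivity), ENNReal.ofReal_mul (by positivity)]
        simp

/-- The law of a fair coin. -/
noncomputable def coin : Measure Bool := (PMF.uniformOfFintype Bool).toMeasure

instance : IsProbabilityMeasure coin := by unfold coin; infer_instance

theorem integral_sgn_coin : ∫ b, sgn b ∂coin = 0 := by
  rw [coin, PMF.integral_eq_sum]
  simp [sgn]

variable {κ : Type*} [Fintype κ]

theorem lintegral_enorm_rademacher_rpow_le (a : κ → ℝ) {p : ℝ} (hp : 1 ≤ p) :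
    ∫⁻ ε, ‖∑ k, sgn (ε k) * a k‖ₑ ^ p ∂Measure.pi (fun _ : κ => coin)
      ≤ (4 * ENNReal.ofReal p * ∑ k, ‖a k‖ₑ ^ (2 : ℝ)) ^ (p / 2) := by
  have h1 : ∀ k, HasSubgaussianMGF (fun ε : κ → Bool => a k * sgn (ε k))
      (⟨a k ^ 2, sq_nonneg _⟩ * 1) (Measure.pi fun _ : κ => coin) := by
    intro k
    refine HasSubgaussianMGF.const_mul ?_ _
    have := hasSubgaussianMGF_of_mem_Icc_of_integral_eq_zero (a := -1) (b := 1)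
      (X := fun ε : κ → Bool => sgn (ε k)) (μ := Measure.pi fun _ : κ => coin)
      (measurable_sgn.comp (measurable_pi_apply k)).aemeasurable
      (Filter.Eventually.of_forall fun ε => by
        cases ε k <;> simp [sgn])
      (by
        rw [← integral_sgn_coin]
        exact integral_comp_eval (μ := fun _ : κ => coin) (f := sgn)
          measurable_sgn.aestronglyMeasurable)
    convert this
    norm_num
  have hind : iIndepFun (fun k (ε : κ → Bool) => a k * sgn (ε k))
      (Measure.pi fun _ : κ => coin) :=
    iIndepFun_pi (X := fun k b => a k * sgn b) fun k =>
      (measurable_sgn.const_mul _).aemeasurable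
  have h2 := HasSubgaussianMGF.sum_of_iIndepFun hind (s := Finset.univ) fun k _ => h1 k
  have h3 := lintegral_enorm_rpow_le_of_subgaussian h2 hp
  simp only [mul_comm (a _)] at h3
  refine h3.trans_eq ?_
  congr 2
  push_cast
  refine Finset.sum_congr rfl fun k _ => ?_
  rw [Real.enorm_eq_ofReal_abs, ENNReal.ofReal_rpow_of_nonneg (abs_nonneg _) (by norm_num),
    Real.rpow_two, sq_abs, ENNReal.ofReal, Real.toNNReal_of_nonneg (sq_nonneg _)]
  exact congrArg _ (mul_one _)

theorem lintegral_enorm_rademacher_sq (a : κ → ℝ) :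
    ∫⁻ ε, ‖∑ k, sgn (ε k) * a k‖ₑ ^ (2 : ℝ) ∂Measure.pi (fun _ : κ => coin)
      = ∑ k, ‖a k‖ₑ ^ (2 : ℝ) := by
  have hsq : ∀ x : ℝ, ‖x‖ₑ ^ (2 : ℝ) = ENNReal.ofReal (x ^ 2) := fun x => by
    rw [Real.enorm_eq_ofReal_abs, ENNReal.ofReal_rpow_of_nonneg (abs_nonneg _) (by norm_num),
      Real.rpow_two, sq_abs]
  have hm : ∀ k, Measurable fun b => sgn b * a k := fun k => measurable_sgn.mul_const _
  have hL : ∀ k, MemLp (fun b => sgn b * a k) 2 coin := fun k =>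
    MemLp.of_bound (hm k).aestronglyMeasurable (|a k|) (Filter.Eventually.of_forall fun b => by
      cases b <;> simp [sgn])
  have h0 : ∀ k, ∫ b, sgn b * a k ∂coin = 0 := fun k => by
    rw [integral_mul_const, integral_sgn_coin, zero_mul]
  have hv := variance_sum_pi (μ := fun _ : κ => coin) hL
  have hLp : ∀ k, MemLp (fun ε : κ → Bool => sgn (ε k) * a k) 2 (Measure.pi fun _ => coin) :=
    fun k => (hL k).comp_measurePreserving (measurePreserving_eval _ k)
  have hS : MemLp (fun ε : κ → Bool => ∑ k, sgn (ε k) * a k) 2 (Measure.pi fun _ => coin) :=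
    memLp_finsetSum _ fun k _ => hLp k
  have hS0 : ∫ ε : κ → Bool, ∑ k, sgn (ε k) * a k ∂Measure.pi (fun _ => coin) = 0 := by
    rw [integral_finsetSum _ fun k _ => (hLp k).integrable (by norm_num)]
    refine Finset.sum_eq_zero fun k _ => ?_
    rw [← h0 k]
    exact integral_comp_eval (μ := fun _ : κ => coin) (f := fun b => sgn b * a k)
      (hm k).aestronglyMeasurable
  have hk : ∀ k, Var[fun b => sgn b * a k; coin] = a k ^ 2 := fun k => by
    rw [variance_of_integral_eq_zero (hm k).aemeasurable (h0 k)]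
    have : ∀ b, (sgn b * a k) ^ 2 = a k ^ 2 := fun b => by cases b <;> simp [sgn]
    simp only [this, integral_const, probReal_univ, one_smul]
  have hsum : (∑ k, fun ε : κ → Bool => sgn (ε k) * a k)
      = fun ε => ∑ k, sgn (ε k) * a k := by
    ext ε; simp
  rw [hsum, variance_of_integral_eq_zero hS.aestronglyMeasurable.aemeasurable hS0] at hv
  simp only [hk] at hv
  simp only [hsq]
  rw [← ofReal_integral_eq_lintegral_ofReal hS.integrable_sq
    (Filter.Eventually.of_forall fun _ => sq_nonneg _), hv,
    ENNReal.ofReal_sum_of_nonneg fun _ _ => sq_nonneg _]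

end Khinchine

/-! ### Decoupled Rademacher chaos -/

section Chaos

variable {ι κ : Type*} [Fintype ι] [DecidableEq ι] [Fintype κ] [DecidableEq κ]

/-- The law of an array of independent fair signs. -/
noncomputable def signArray (ι κ : Type*) [Fintype ι] [Fintype κ] : Measure (ι → κ → Bool) :=
  Measure.pi fun _ => Measure.pi fun _ => coin

instance : IsProbabilityMeasure (signArray ι κ) := by unfold signArray; infer_instance

/-- The Rademacher chaos in the rows in `s`, the other indices being frozen at `i`. -/
def chaos (c : (ι → κ) → ℝ) (s : Finset ι) (i : ι → κ) (ε : ι → κ → Bool) : ℝ :=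
  ∑ i' ∈ idxClass s i, sgnProd s ε i' * c i'

theorem measurable_chaos (c : (ι → κ) → ℝ) (s : Finset ι) (i : ι → κ) :
    Measurable (chaos c s i) := by
  unfold chaos
  exact Finset.measurable_sum _ fun i' _ => (measurable_sgnProd s i').mul_const _

theorem sum_idxClass_insert {M : Type*} [AddCommMonoid M] {s : Finset ι} {j : ι} (hj : j ∉ s)
    (f : (ι → κ) → M) (i : ι → κ) :
    ∑ i' ∈ idxClass (insert j s) i, f i'
      = ∑ k, ∑ i' ∈ idxClass s (Function.update i j k), f i' := by
  rw [← Finset.sum_fiberwise (idxClass (insert j s) i) (fun i' => i' j)]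
  refine Finset.sum_congr rfl fun k _ => Finset.sum_congr ?_ fun _ _ => rfl
  ext i'
  rw [Finset.mem_filter, mem_idxClass_update hj]

theorem chaos_insert (c : (ι → κ) → ℝ) {s : Finset ι} {j : ι} (hj : j ∉ s) (i : ι → κ)
    (ε : ι → κ → Bool) :
    chaos c (insert j s) i ε = ∑ k, sgn (ε j k) * chaos c s (Function.update i j k) ε := by
  rw [chaos, sum_idxClass_insert hj]
  refine Finset.sum_congr rfl fun k _ => ?_
  rw [chaos, Finset.mul_sum]
  refine Finset.sum_congr rfl fun i' hi' => ?_
  rw [sgnProd, Finset.prod_insert hj, ((mem_idxClass_update hj).1 hi').2, sgnProd, mul_assoc]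

theorem chaos_update (c : (ι → κ) → ℝ) {s : Finset ι} {j : ι} (hj : j ∉ s) (i : ι → κ)
    (ε : ι → κ → Bool) (η : κ → Bool) : chaos c s i (Function.update ε j η) = chaos c s i ε := by
  refine Finset.sum_congr rfl fun i' _ => ?_
  congr 1
  refine Finset.prod_congr rfl fun l hl => ?_
  rw [Function.update_of_ne (by rintro rfl; exact hj hl)]

theorem lintegral_chaos_insert (c : (ι → κ) → ℝ) {s : Finset ι} {j : ι} (hj : j ∉ s) (i : ι → κ)
    (p : ℝ) :
    ∫⁻ ε, ‖chaos c (insert j s) i ε‖ₑ ^ p ∂signArray ι κ = ∫⁻ ε, ∫⁻ η,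
      ‖∑ k, sgn (η k) * chaos c s (Function.update i j k) ε‖ₑ ^ p ∂Measure.pi (fun _ : κ => coin)
        ∂signArray ι κ := by
  rw [signArray, ← lintegral_update j ((measurable_chaos c _ i).enorm.pow_const p)]
  simp only [chaos_insert c hj, chaos_update c hj, Function.update_self]

theorem lintegral_chaos_sq (c : (ι → κ) → ℝ) (s : Finset ι) (i : ι → κ) :
    ∫⁻ ε, ‖chaos c s i ε‖ₑ ^ (2 : ℝ) ∂signArray ι κ
      = ∑ i' ∈ idxClass s i, ‖c i'‖ₑ ^ (2 : ℝ) := by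
  induction s using Finset.induction_on generalizing i with
  | empty => simp [chaos, idxClass_empty, sgnProd]
  | insert j s hj ih =>
    rw [lintegral_chaos_insert c hj]
    simp only [lintegral_enorm_rademacher_sq]
    rw [lintegral_finsetSum _ fun k _ => (measurable_chaos c s _).enorm.pow_const _,
      sum_idxClass_insert hj]
    exact Finset.sum_congr rfl fun k _ => ih _

theorem lintegral_rpow_sum_le {Ω α : Type*} [MeasurableSpace Ω] {μ : Measure Ω} (t : Finset α)
    {f : α → Ω → ℝ≥0∞} (hf : ∀ a, Measurable (f a)) {r : ℝ} (hr : 1 ≤ r) :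
    (∫⁻ ω, (∑ a ∈ t, f a ω) ^ r ∂μ) ^ (1 / r) ≤ ∑ a ∈ t, (∫⁻ ω, f a ω ^ r ∂μ) ^ (1 / r) := by
  have hr0 : 0 < r := by linarith
  classical
  induction t using Finset.induction_on with
  | empty => simp [hr0]
  | insert a t ha ih =>
    simp only [Finset.sum_insert ha]
    refine (ENNReal.lintegral_Lp_add_le (f := f a) (g := fun ω => ∑ b ∈ t, f b ω)
      (hf a).aemeasurable (by fun_prop) hr).trans ?_
    gcongr

/-- Each row costs a factor `4p`: Khinchine in that row, conditionally on the others, leaves a sum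
of squared chaoses, to which Minkowski in `L^(p/2)` applies. Stating the bound for the squared norm
lets these sums be iterated without loss. -/
theorem lintegral_chaos_rpow_le (c : (ι → κ) → ℝ) {p : ℝ} (hp : 2 ≤ p) (s : Finset ι)
    (i : ι → κ) :
    (∫⁻ ε, ‖chaos c s i ε‖ₑ ^ p ∂signArray ι κ) ^ (2 / p)
      ≤ (4 * ENNReal.ofReal p) ^ s.card * ∑ i' ∈ idxClass s i, ‖c i'‖ₑ ^ (2 : ℝ) := by
  have hp0 : 0 < p := by linarith
  have hpow : ∀ y : ℝ≥0∞, (y ^ (p / 2)) ^ (2 / p) = y := fun y => by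
    rw [← ENNReal.rpow_mul, div_mul_div_cancel₀ (by norm_num), div_self hp0.ne', ENNReal.rpow_one]
  induction s using Finset.induction_on generalizing i with
  | empty =>
    simp only [chaos, idxClass_empty, sgnProd]
    simp [← ENNReal.rpow_mul, mul_div_cancel₀ _ hp0.ne']
  | insert j s hj ih =>
    rw [lintegral_chaos_insert c hj]
    have hm : ∀ i, Measurable fun ε => ‖chaos c s i ε‖ₑ ^ (2 : ℝ) := fun i =>
      (measurable_chaos c s i).enorm.pow_const _
    calc _ ≤ (∫⁻ ε, (4 * ENNReal.ofReal p *
            ∑ k, ‖chaos c s (Function.update i j k) ε‖ₑ ^ (2 : ℝ)) ^ (p / 2) ∂signArray ι κ)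
              ^ (2 / p) := by
          gcongr
          exact lintegral_enorm_rademacher_rpow_le _ (by linarith)
      _ = 4 * ENNReal.ofReal p * (∫⁻ ε, (∑ k,
            ‖chaos c s (Function.update i j k) ε‖ₑ ^ (2 : ℝ)) ^ (p / 2) ∂signArray ι κ)
              ^ (1 / (p / 2)) := by
          have e : ∀ ε, (4 * ENNReal.ofReal p *
              ∑ k, ‖chaos c s (Function.update i j k) ε‖ₑ ^ (2 : ℝ)) ^ (p / 2)
              = (4 * ENNReal.ofReal p) ^ (p / 2) *
                (∑ k, ‖chaos c s (Function.update i j k) ε‖ₑ ^ (2 : ℝ)) ^ (p / 2) := fun ε =>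
            ENNReal.mul_rpow_of_nonneg _ _ (by positivity)
          simp only [e]
          rw [lintegral_const_mul _ (by fun_prop), ENNReal.mul_rpow_of_nonneg _ _ (by positivity),
            hpow,
            one_div_div]
      _ ≤ 4 * ENNReal.ofReal p * ∑ k, (4 * ENNReal.ofReal p) ^ s.card *
            ∑ i' ∈ idxClass s (Function.update i j k), ‖c i'‖ₑ ^ (2 : ℝ) := by
          gcongr
          refine (lintegral_rpow_sum_le _ (fun k => hm _) (by linarith)).trans ?_
          refine Finset.sum_le_sum fun k _ => ?_
          refine le_trans (le_of_eq ?_) (ih (Function.update i j k))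
          rw [one_div_div]
          congr 1
          refine lintegral_congr fun ε => ?_
          rw [← ENNReal.rpow_mul, mul_div_cancel₀ _ (by norm_num)]
      _ = _ := by
          rw [sum_idxClass_insert hj, Finset.card_insert_of_notMem hj, ← Finset.mul_sum, pow_succ]
          ring

end Chaos

/-! ### Comparison with the square function and with the mixed moments -/

section SquareFunction

variable {ι κ S : Type*} [Fintype ι] [DecidableEq ι] [Fintype κ] [DecidableEq κ]
  [MeasurableSpace S] {ρ : ι → κ → Measure S} [∀ j k, IsProbabilityMeasure (ρ j k)]
  {H : (ι → κ) → (ι → κ → S) → ℝ}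

theorem sum_sq_rpow_le_lintegral_sgnProd (c : (ι → κ) → ℝ) {p : ℝ} (hp : 2 ≤ p) :
    (∑ i, ‖c i‖ₑ ^ (2 : ℝ)) ^ (p / 2)
      ≤ ∫⁻ ε, ‖∑ i, sgnProd Finset.univ ε i * c i‖ₑ ^ p ∂signArray ι κ := by
  rcases isEmpty_or_nonempty (ι → κ) with h | ⟨⟨i⟩⟩
  · simp [show 0 < p by linarith]
  have hu : idxClass (κ := κ) Finset.univ i = Finset.univ := by ext; simp [mem_idxClass]
  have h1 := lintegral_chaos_sq c Finset.univ i
  rw [hu] at h1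
  rw [← h1]
  refine (rpow_lintegral_le ((measurable_chaos c _ i).enorm.pow_const _).aemeasurable
    (by linarith)).trans_eq ?_
  refine lintegral_congr fun ε => ?_
  rw [← ENNReal.rpow_mul, mul_div_cancel₀ _ (by norm_num), chaos, hu]

theorem lintegral_sgnProd_le_sum_sq_rpow (c : (ι → κ) → ℝ) {p : ℝ} (hp : 2 ≤ p) :
    ∫⁻ ε, ‖∑ i, sgnProd Finset.univ ε i * c i‖ₑ ^ p ∂signArray ι κ
      ≤ ((4 * ENNReal.ofReal p) ^ Fintype.card ι) ^ (p / 2) *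
        (∑ i, ‖c i‖ₑ ^ (2 : ℝ)) ^ (p / 2) := by
  have hp0 : 0 < p := by linarith
  rcases isEmpty_or_nonempty (ι → κ) with h | ⟨⟨i⟩⟩
  · simp [hp0]
  have hu : idxClass (κ := κ) Finset.univ i = Finset.univ := by ext; simp [mem_idxClass]
  have h1 := lintegral_chaos_rpow_le c hp Finset.univ i
  rw [hu] at h1
  have h2 := ENNReal.rpow_le_rpow h1 (show 0 ≤ p / 2 by positivity)
  rw [← ENNReal.rpow_mul, div_mul_div_cancel₀ hp0.ne', div_self two_ne_zero, ENNReal.rpow_one,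
    ENNReal.mul_rpow_of_nonneg _ _ (by positivity)] at h2
  simpa only [chaos, hu, Finset.card_univ] using h2

theorem CanonicalFamily.measurable_signed (hH : CanonicalFamily (fun j => Measure.pi (ρ j)) H)
    (p : ℝ) : Measurable fun z : (ι → κ → Bool) × (ι → κ → S) =>
      ‖∑ i, sgnProd Finset.univ z.1 i * H i z.2‖ₑ ^ p := by
  refine (Measurable.enorm (Finset.measurable_sum _ fun i _ => ?_)).pow_const p
  exact ((measurable_sgnProd _ i).comp measurable_fst).mul ((hH.measurable i).comp measurable_snd)

/-- The moments of a canonical sum are controlled by those of its square function. -/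
theorem CanonicalFamily.lintegral_rpow_le_squareFunction
    (hH : CanonicalFamily (fun j => Measure.pi (ρ j)) H) {p : ℝ} (hp : 2 ≤ p) :
    ∫⁻ x, ‖∑ i, H i x‖ₑ ^ p ∂Measure.pi (fun j => Measure.pi (ρ j))
      ≤ (2 ^ p) ^ Fintype.card ι * (((4 * ENNReal.ofReal p) ^ Fintype.card ι) ^ (p / 2) *
        ∫⁻ x, (∑ i, ‖H i x‖ₑ ^ (2 : ℝ)) ^ (p / 2) ∂Measure.pi (fun j => Measure.pi (ρ j))) := by
  have hHm := hH.measurable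
  set P := Measure.pi (fun j => Measure.pi (ρ j)) with hP
  calc ∫⁻ x, ‖∑ i, H i x‖ₑ ^ p ∂P
      = ∫⁻ _ε, (∫⁻ x, ‖∑ i, H i x‖ₑ ^ p ∂P) ∂signArray ι κ := by simp
    _ ≤ ∫⁻ ε, (2 ^ p) ^ Fintype.card ι *
          ∫⁻ x, ‖∑ i, sgnProd Finset.univ ε i * H i x‖ₑ ^ p ∂P ∂signArray ι κ := by
        refine lintegral_mono fun ε => ?_
        simpa using hH.lintegral_le_sgnProd Finset.univ ε (by linarith)
    _ = (2 ^ p) ^ Fintype.card ι * ∫⁻ x, ∫⁻ ε,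
          ‖∑ i, sgnProd Finset.univ ε i * H i x‖ₑ ^ p ∂signArray ι κ ∂P := by
        rw [lintegral_const_mul _ (hH.measurable_signed p).lintegral_prod_right,
          lintegral_lintegral_swap (hH.measurable_signed p).aemeasurable]
    _ ≤ _ := by
        gcongr
        rw [← lintegral_const_mul _ (by fun_prop)]
        exact lintegral_mono fun x => lintegral_sgnProd_le_sum_sq_rpow (fun i => H i x) hp

/-- The moments of the square function of a canonical sum are controlled by those of the sum. -/
theorem CanonicalFamily.squareFunction_le_lintegral_rpow
    (hH : CanonicalFamily (fun j => Measure.pi (ρ j)) H) {p : ℝ} (hp : 2 ≤ p) :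
    ∫⁻ x, (∑ i, ‖H i x‖ₑ ^ (2 : ℝ)) ^ (p / 2) ∂Measure.pi (fun j => Measure.pi (ρ j))
      ≤ (2 ^ p) ^ Fintype.card ι *
        ∫⁻ x, ‖∑ i, H i x‖ₑ ^ p ∂Measure.pi (fun j => Measure.pi (ρ j)) := by
  set P := Measure.pi (fun j => Measure.pi (ρ j)) with hP
  calc _ ≤ ∫⁻ x, ∫⁻ ε, ‖∑ i, sgnProd Finset.univ ε i * H i x‖ₑ ^ p ∂signArray ι κ ∂P :=
        lintegral_mono fun x => sum_sq_rpow_le_lintegral_sgnProd (fun i => H i x) hp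
    _ = ∫⁻ ε, ∫⁻ x, ‖∑ i, sgnProd Finset.univ ε i * H i x‖ₑ ^ p ∂P ∂signArray ι κ :=
        (lintegral_lintegral_swap (hH.measurable_signed p).aemeasurable).symm
    _ ≤ ∫⁻ _ε, (2 ^ p) ^ Fintype.card ι * ∫⁻ x, ‖∑ i, H i x‖ₑ ^ p ∂P ∂signArray ι κ := by
        refine lintegral_mono fun ε => ?_
        simpa using hH.lintegral_sgnProd_le Finset.univ ε (by linarith)
    _ = _ := by simp

/-- The family of squared kernels. -/
noncomputable def sqFamily (H : (ι → κ) → (ι → κ → S) → ℝ) (i : ι → κ) (x : ι → κ → S) : ℝ≥0∞ :=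
  ‖H i x‖ₑ ^ (2 : ℝ)

/-- `E max_{𝐢_J} (∑_{𝐢_{Jᶜ}} E_{Jᶜ} H_𝐢²)^{p/2}` on the product space. -/
noncomputable def prodMoment (ν : ι → Measure (κ → S)) (H : (ι → κ) → (ι → κ → S) → ℝ) (i : ι → κ)
    (p : ℝ) (J : Finset ι) : ℝ≥0∞ :=
  ∫⁻ x, maxOp J (sumExp ν Jᶜ (sqFamily H)) i x ^ (p / 2) ∂Measure.pi ν

/-- The constant in the moment inequality for canonical kernels. -/
def momentConst (m : ℕ) : ℕ := 4 ^ m * nonnegConst m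

theorem one_le_momentConst (m : ℕ) : 1 ≤ momentConst m :=
  Nat.mul_pos (by positivity) (one_le_nonnegConst m)

theorem CanonicalFamily.lintegral_rpow_le_prodMoment
    (hH : CanonicalFamily (fun j => Measure.pi (ρ j)) H) {p : ℝ} (hp : 2 < p) (i : ι → κ) :
    ∫⁻ x, ‖∑ i, H i x‖ₑ ^ p ∂Measure.pi (fun j => Measure.pi (ρ j))
      ≤ (momentConst (Fintype.card ι) : ℝ≥0∞) ^ p * ENNReal.ofReal p ^ (Fintype.card ι * p / 2) *
        ∑ J : Finset ι, ENNReal.ofReal p ^ (J.card * p / 2) *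
          prodMoment (fun j => Measure.pi (ρ j)) H i p J := by
  have hp0 : 0 ≤ p := by linarith
  set m := Fintype.card ι with hm
  set ν : ι → Measure (κ → S) := fun j => Measure.pi (ρ j) with hν
  have hsm : ∀ i, Measurable (sqFamily H i) := fun i => (hH.measurable i).enorm.pow_const _
  have hsa : ∀ j, AdaptedAt j (sqFamily H) := fun j i x y y' h => by
    simp only [sqFamily, hH.adapted i j x y y' h]
  have hu : ∀ i', idxClass (κ := κ) Finset.univ i' = (Finset.univ : Finset (ι → κ)) := fun i' => by
    ext; simp [mem_idxClass]
  have h1 : ∫⁻ x, (∑ i, ‖H i x‖ₑ ^ (2 : ℝ)) ^ (p / 2) ∂Measure.pi ν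
      ≤ (nonnegConst m : ℝ≥0∞) ^ (p / 2) * ∑ J : Finset ι,
        ENNReal.ofReal (p / 2) ^ (J.card * (p / 2)) * prodMoment ν H i p J := by
    have hM : ∀ J : Finset ι, Measurable (maxMoment ν (p / 2) J (Finset.univ \ J) (sqFamily H) i) :=
      fun J => measurable_maxMoment hsm _ _ _ i
    calc _ = ∫⁻ _x : ι → κ → S, (∫⁻ x, (∑ i, ‖H i x‖ₑ ^ (2 : ℝ)) ^ (p / 2) ∂Measure.pi ν)
          ∂Measure.pi ν := by simp
      _ ≤ ∫⁻ x, (nonnegConst m : ℝ≥0∞) ^ (p / 2) * ∑ J : Finset ι,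
        ENNReal.ofReal (p / 2) ^ (J.card * (p / 2)) *
          maxMoment ν (p / 2) J (Finset.univ \ J) (sqFamily H) i x ∂Measure.pi ν := by
          refine lintegral_mono fun x => ?_
          have := expOp_rpow_sumOp_le (ν := ν) (ρ := ρ) (fun _ => rfl) (r := p / 2) (by linarith)
            Finset.univ hsm (fun j _ => hsa j) i x
          simpa only [expOp, lmarginal_univ, sumOp, hu, sqFamily, Finset.powerset_univ,
            Finset.card_univ] using this
      _ = _ := by
          rw [lintegral_const_mul _ (by fun_prop), lintegral_finsetSum _ (by fun_prop)]
          congr 1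
          refine Finset.sum_congr rfl fun J _ => ?_
          rw [lintegral_const_mul _ (hM J)]
          congr 1
          exact lintegral_lmarginal J ((measurable_maxOp (measurable_sumExp hsm) i).pow_const _)
  refine (hH.lintegral_rpow_le_squareFunction hp.le).trans ?_
  have hc : (nonnegConst m : ℝ≥0∞) ^ (p / 2) ≤ (nonnegConst m : ℝ≥0∞) ^ p :=
    ENNReal.rpow_le_rpow_of_exponent_le (by exact_mod_cast one_le_nonnegConst m) (by linarith)
  calc _ ≤ (2 ^ p) ^ m * (((4 * ENNReal.ofReal p) ^ m) ^ (p / 2) *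
          ((nonnegConst m : ℝ≥0∞) ^ p * ∑ J : Finset ι,
            ENNReal.ofReal p ^ (J.card * p / 2) * prodMoment ν H i p J)) := by
        gcongr
        refine h1.trans ?_
        gcongr with J
        rw [mul_div_assoc]
        gcongr
        linarith
    _ = _ := by
        rw [momentConst, mul_pow, ENNReal.mul_rpow_of_nonneg _ _ (by positivity)]
        push_cast
        rw [ENNReal.mul_rpow_of_nonneg _ _ hp0]
        have e1 : (ENNReal.ofReal p ^ m) ^ (p / 2) = ENNReal.ofReal p ^ (m * p / 2) := by
          rw [← ENNReal.rpow_natCast, ← ENNReal.rpow_mul, mul_div_assoc]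
        -- The `4 ^ m` in `momentConst` collects the `2^(mp)` of the sign insertion and the
        -- `4^(mp/2)` of Khinchine.
        have e2 : ((4 : ℝ≥0∞) ^ m) ^ p = (2 ^ p) ^ m * ((4 : ℝ≥0∞) ^ m) ^ (p / 2) := by
          simp only [← ENNReal.rpow_natCast, ← ENNReal.rpow_mul]
          rw [show (4 : ℝ≥0∞) = 2 ^ (2 : ℝ) by norm_num]
          simp only [← ENNReal.rpow_mul]
          rw [← ENNReal.rpow_add_of_nonneg _ _ (by positivity) (by positivity)]
          ring_nf
        rw [e1, e2]
        ring

theorem prodMoment_empty (i : ι → κ) (p : ℝ) (hHm : ∀ i, Measurable (H i)) :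
    prodMoment (fun j => Measure.pi (ρ j)) H i p ∅
      = (∫⁻ x, ∑ i, ‖H i x‖ₑ ^ (2 : ℝ) ∂Measure.pi (fun j => Measure.pi (ρ j))) ^ (p / 2) := by
  have hu : ∀ i', idxClass (κ := κ) Finset.univ i' = (Finset.univ : Finset (ι → κ)) := fun i' => by
    ext; simp [mem_idxClass]
  rw [lintegral_finsetSum _ (by fun_prop)]
  simp [prodMoment, maxOp_empty, sumExp, sumOp, hu, expOp, sqFamily]

/-- Lyapunov's inequality, used to carry domination by the variance from the exponent `p` down to
`min p 4`. -/
theorem prodMoment_le_rpow (i : ι → κ) (hHm : ∀ i, Measurable (H i)) {p q : ℝ} (hq : 0 < q)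
    (hqp : q ≤ p) (J : Finset ι) :
    prodMoment (fun j => Measure.pi (ρ j)) H i q J
      ≤ prodMoment (fun j => Measure.pi (ρ j)) H i p J ^ (q / p) := by
  have hm : Measurable (maxOp J (sumExp (fun j => Measure.pi (ρ j)) Jᶜ (sqFamily H)) i) :=
    measurable_maxOp (measurable_sumExp fun i => (hHm i).enorm.pow_const _) i
  refine (lintegral_rpow_le_rpow_lintegral hm.aemeasurable (by positivity)
    (by linarith : q / 2 ≤ p / 2)).trans_eq ?_
  rw [div_div_div_cancel_right₀ two_ne_zero]
  rfl

end SquareFunction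

/-! ### From a small tail to a bound on the variance -/

section Tail

variable {Ω : Type*} [MeasurableSpace Ω] {μ : Measure Ω} [IsProbabilityMeasure μ] {U : Ω → ℝ}

theorem rpow_mul_measure_lt_abs_le (hU : Measurable U) {p t : ℝ} (hp : 0 ≤ p) :
    ENNReal.ofReal t ^ p * μ {ω | t < |U ω|} ≤ ∫⁻ ω, ‖U ω‖ₑ ^ p ∂μ := by
  refine le_trans ?_ (mul_meas_ge_le_lintegral (hU.enorm.pow_const p) (ENNReal.ofReal t ^ p))
  gcongr with ω
  intro h
  simp only [Real.enorm_eq_ofReal_abs] at h ⊢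
  gcongr

/-- Split the second moment at `|U| = t` and use Hölder with exponents `q/2` and `q/(q-2)` on the
large part. -/
theorem lintegral_sq_le_tail (hU : Measurable U) {q : ℝ} (hq : 2 < q) (t : ℝ) :
    ∫⁻ ω, ‖U ω‖ₑ ^ (2 : ℝ) ∂μ ≤ ENNReal.ofReal t ^ (2 : ℝ)
      + (∫⁻ ω, ‖U ω‖ₑ ^ q ∂μ) ^ (2 / q) * μ {ω | t < |U ω|} ^ ((q - 2) / q) := by
  have hq0 : 0 < q := by linarith
  have hB : MeasurableSet {ω | t < |U ω|} := measurableSet_lt measurable_const (by fun_prop)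
  set B := {ω | t < |U ω|}
  have hconj : (q / 2).HolderConjugate (q / (q - 2)) := by
    rw [Real.holderConjugate_iff]
    have : q - 2 ≠ 0 := by linarith
    constructor
    · linarith
    · field_simp
      ring
  have hH := ENNReal.lintegral_mul_le_Lp_mul_Lq μ hconj
    (f := fun ω => ‖U ω‖ₑ ^ (2 : ℝ)) (g := B.indicator fun _ => 1)
    (by fun_prop) (aemeasurable_const.indicator hB)
  have hg : ∫⁻ ω, (B.indicator (fun _ => (1 : ℝ≥0∞)) ω) ^ (q / (q - 2)) ∂μ = μ B := by
    rw [← lintegral_indicator_one hB]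
    refine lintegral_congr fun ω => ?_
    by_cases h : ω ∈ B
    · simp [h]
    · simp [h, div_pos hq0 (by linarith : 0 < q - 2)]
  have hf : ∀ ω, (‖U ω‖ₑ ^ (2 : ℝ)) ^ (q / 2) = ‖U ω‖ₑ ^ q := fun ω => by
    rw [← ENNReal.rpow_mul, mul_div_cancel₀ _ two_ne_zero]
  rw [hg] at hH
  simp only [Pi.mul_apply, hf, one_div_div] at hH
  calc _ ≤ ∫⁻ ω, ENNReal.ofReal t ^ (2 : ℝ)
          + ‖U ω‖ₑ ^ (2 : ℝ) * B.indicator (fun _ => 1) ω ∂μ := by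
        refine lintegral_mono fun ω => ?_
        by_cases h : ω ∈ B
        · simp [h]
        · refine le_trans ?_ le_self_add
          rw [Real.enorm_eq_ofReal_abs]
          gcongr
          exact not_lt.1 h
    _ = ENNReal.ofReal t ^ (2 : ℝ)
          + ∫⁻ ω, ‖U ω‖ₑ ^ (2 : ℝ) * B.indicator (fun _ => 1) ω ∂μ := by
        rw [lintegral_add_left measurable_const]
        simp
    _ ≤ _ := by gcongr

/-- Paley-Zygmund in contrapositive form. Hypercontractivity and the tail bound make the
contribution of `|U| > t` at most `V / 2`, which is absorbed into the left-hand side because `V` is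
finite. -/
theorem le_sq_of_tail_le (hU : Measurable U) {q : ℝ} (hq : 2 < q) {V : ℝ≥0∞} (hV : V ≠ ∞)
    {c D : ℕ} (hc : 1 ≤ c) (hD : 1 ≤ D) (hVU : V ≤ c * ∫⁻ ω, ‖U ω‖ₑ ^ (2 : ℝ) ∂μ)
    (hUq : ∫⁻ ω, ‖U ω‖ₑ ^ q ∂μ ≤ D * V ^ (q / 2)) {t : ℝ}
    (ht : μ.real {ω | t < |U ω|} ≤ (1 / (2 * c * D : ℝ)) ^ (q / (q - 2))) :
    V ≤ 2 * c * ENNReal.ofReal t ^ (2 : ℝ) := by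
  have hq0 : 0 < q := by linarith
  have hq2 : 0 < q - 2 := by linarith
  have hc0 : (0 : ℝ) < c := by exact_mod_cast hc
  have hD0 : (0 : ℝ) < D := by exact_mod_cast hD
  set P := μ {ω | t < |U ω|} with hP
  have hPle : P ^ ((q - 2) / q) ≤ ENNReal.ofReal (1 / (2 * c * D)) := by
    have h1 : P ≤ ENNReal.ofReal ((1 / (2 * c * D : ℝ)) ^ (q / (q - 2))) := by
      rw [hP, ← ofReal_measureReal]
      exact ENNReal.ofReal_le_ofReal ht
    refine (ENNReal.rpow_le_rpow h1 (by positivity)).trans_eq ?_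
    rw [ENNReal.ofReal_rpow_of_nonneg (by positivity) (by positivity), ← Real.rpow_mul
      (by positivity), div_mul_div_cancel₀ hq2.ne', div_self hq0.ne', Real.rpow_one]
  have hEq : (∫⁻ ω, ‖U ω‖ₑ ^ q ∂μ) ^ (2 / q) ≤ D * V := by
    refine (ENNReal.rpow_le_rpow hUq (by positivity)).trans ?_
    rw [ENNReal.mul_rpow_of_nonneg _ _ (by positivity), ← ENNReal.rpow_mul,
      div_mul_div_cancel₀ two_ne_zero, div_self hq0.ne', ENNReal.rpow_one]
    gcongr
    nth_rewrite 2 [← ENNReal.rpow_one (D : ℝ≥0∞)]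
    refine ENNReal.rpow_le_rpow_of_exponent_le (by exact_mod_cast hD) ?_
    rw [div_le_one hq0]
    exact hq.le
  have hhalf : (c : ℝ≥0∞) * D * ENNReal.ofReal (1 / (2 * c * D)) = 2⁻¹ := by
    rw [← ENNReal.ofReal_natCast c, ← ENNReal.ofReal_natCast D, ← ENNReal.ofReal_mul hc0.le,
      ← ENNReal.ofReal_mul (by positivity)]
    rw [show (c : ℝ) * D * (1 / (2 * c * D)) = 2⁻¹ by field_simp]
    rw [ENNReal.ofReal_inv_of_pos two_pos]
    simp
  have hmain : V ≤ c * ENNReal.ofReal t ^ (2 : ℝ) + V / 2 := by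
    calc V ≤ c * (ENNReal.ofReal t ^ (2 : ℝ)
          + (∫⁻ ω, ‖U ω‖ₑ ^ q ∂μ) ^ (2 / q) * P ^ ((q - 2) / q)) :=
          hVU.trans (by gcongr; exact lintegral_sq_le_tail hU hq t)
      _ ≤ c * (ENNReal.ofReal t ^ (2 : ℝ) + (D * V) * ENNReal.ofReal (1 / (2 * c * D))) := by
          gcongr
      _ = c * ENNReal.ofReal t ^ (2 : ℝ) + V * (c * D * ENNReal.ofReal (1 / (2 * c * D))) := by
          ring
      _ = _ := by rw [hhalf, ENNReal.div_eq_inv_mul, mul_comm V]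
  have hV2 : V / 2 ≠ ∞ := by finiteness
  have h2 : V / 2 ≤ c * ENNReal.ofReal t ^ (2 : ℝ) := by
    nth_rewrite 1 [← ENNReal.add_halves V] at hmain
    exact (ENNReal.add_le_add_iff_right hV2).1 hmain
  calc V = V / 2 + V / 2 := (ENNReal.add_halves V).symm
    _ ≤ c * ENNReal.ofReal t ^ (2 : ℝ) + c * ENNReal.ofReal t ^ (2 : ℝ) := by gcongr
    _ = _ := by ring

end Tail

/-! ### Estimates of the level -/

section Level

theorem level_pos {K p : ℝ} (hK : 0 < K) (m : ℕ) (hp : 2 < p) : 0 < level K m p := by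
  have : 0 < p := by linarith
  unfold level
  positivity

/-- After cancelling the common power of `K p^(m/2)`, what remains is `2^(1/(p-2)) ≤ (4 *
3/4)^(p/(p-2))`. -/
theorem inv_rpow_le_level {K p : ℝ} (hK : 0 < K) (m : ℕ) (hp : 2 < p) :
    1 / (4 * K * p ^ ((m : ℝ) / 2)) ^ (p / (p - 2)) ≤ level K m p := by
  have hp0 : 0 < p := by linarith
  have hp2 : 0 < p - 2 := by linarith
  have e1 : (2 * K ^ p * p ^ (m * p / 2)) ^ (1 / (p - 2))
      = 2 ^ (1 / (p - 2)) * (K * p ^ ((m : ℝ) / 2)) ^ (p / (p - 2)) := by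
    have e2 : K ^ p * p ^ (m * p / 2) = (K * p ^ ((m : ℝ) / 2)) ^ p := by
      rw [Real.mul_rpow hK.le (by positivity), ← Real.rpow_mul hp0.le]
      ring_nf
    rw [mul_assoc, e2, Real.mul_rpow (by positivity) (by positivity), ← Real.rpow_mul
      (by positivity), mul_one_div]
  rw [level, e1, mul_assoc, Real.mul_rpow (by norm_num) (by positivity), mul_one_div,
    div_le_div_iff₀ (by positivity) (by positivity), one_mul, ← mul_assoc]
  gcongr
  rw [← Real.mul_rpow (by norm_num) (by norm_num)]
  calc (2 : ℝ) ^ (1 / (p - 2)) ≤ 3 ^ (1 / (p - 2)) := by gcongr; norm_num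
    _ ≤ 3 ^ (p / (p - 2)) := by
        apply Real.rpow_le_rpow_of_exponent_le (by norm_num)
        gcongr
        linarith
    _ = _ := by norm_num

/-- The reason for taking `K` to be a square: the doubled exponent `2p/(p-2)` dominates `q/(q-2)`
for `q = min p 4`, which equals `p/(p-2)` when `p ≤ 4` and `2` when `p ≥ 4`. -/
theorem level_sq_le {N p : ℝ} (hN : 1 ≤ N) (m : ℕ) (hp : 2 < p) :
    level (N ^ 2) m p ≤ (1 / N) ^ (min p 4 / (min p 4 - 2)) := by
  have hp0 : 0 < p := by linarith
  have hp2 : 0 < p - 2 := by linarith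
  have hN0 : 0 < N := by linarith
  have hexp : min p 4 / (min p 4 - 2) ≤ 2 * p / (p - 2) := by
    rcases le_total p 4 with h | h
    · rw [min_eq_left h]
      gcongr
      linarith
    · rw [min_eq_right h, le_div_iff₀ hp2]
      linarith
  have h1 : (1 : ℝ) ≤ p ^ (m * p / 2) := Real.one_le_rpow (by linarith) (by positivity)
  calc level (N ^ 2) m p ≤ 1 * (1 / ((N ^ 2) ^ p) ^ (1 / (p - 2))) := by
        unfold level
        gcongr
        · exact Real.rpow_le_one (by norm_num) (by norm_num) (by positivity)
        · have : 0 < (N ^ 2) ^ p := by positivity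
          nlinarith
    _ = (1 / N) ^ (2 * p / (p - 2)) := by
        rw [one_mul, ← Real.rpow_mul (by positivity), mul_one_div, ← Real.rpow_two,
          ← Real.rpow_mul hN0.le, Real.div_rpow zero_le_one hN0.le, Real.one_rpow, mul_div_assoc]
    _ ≤ _ := by
        apply Real.rpow_le_rpow_of_exponent_ge (by positivity) _ hexp
        rw [div_le_one hN0]
        exact hN

end Level

/-! ### From the random variables to the product space -/

section Transfer

variable {Ω S : Type*} {m n : ℕ} [MeasurableSpace Ω] [MeasurableSpace S] {μ : Measure Ω}
  [IsProbabilityMeasure μ] {X : Fin m → Fin n → Ω → S}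
  {h : (Fin m → Fin n) → (Fin m → S) → ℝ}

/-- The kernel `h_𝐢` as a function of the array. -/
def arrKernel (h : (Fin m → Fin n) → (Fin m → S) → ℝ) (i : Fin m → Fin n)
    (x : Fin m → Fin n → S) : ℝ := h i (select i x)

/-- The law of the `j`-th row. -/
noncomputable def rowLaw (μ : Measure Ω) (X : Fin m → Fin n → Ω → S) (j : Fin m) :
    Measure (Fin n → S) := Measure.pi fun k => μ.map (X j k)

theorem isProbabilityMeasure_map (hX : ∀ j k, Measurable (X j k)) (j : Fin m) (k : Fin n) :
    IsProbabilityMeasure (μ.map (X j k)) :=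
  Measure.isProbabilityMeasure_map (hX j k).aemeasurable

theorem isProbabilityMeasure_rowLaw (hX : ∀ j k, Measurable (X j k)) (j : Fin m) :
    IsProbabilityMeasure (rowLaw μ X j) := by
  have := isProbabilityMeasure_map (μ := μ) hX
  unfold rowLaw
  infer_instance

theorem measurable_arr (hX : ∀ j k, Measurable (X j k)) : Measurable (arr X) :=
  measurable_pi_lambda _ fun j => measurable_pi_lambda _ fun k => hX j k

theorem measurable_arrKernel (hh : ∀ i, Measurable (h i)) (i : Fin m → Fin n) :
    Measurable (arrKernel h i) := by
  refine (hh i).comp (measurable_pi_lambda _ fun j => ?_)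
  unfold select
  fun_prop

theorem map_row (hX : ∀ j k, Measurable (X j k))
    (hind : iIndepFun (fun q : Fin m × Fin n => X q.1 q.2) μ) (j : Fin m) :
    μ.map (fun ω k => X j k ω) = rowLaw μ X j := by
  have h1 : iIndepFun (fun k => X j k) μ :=
    hind.precomp (g := fun k : Fin n => (j, k)) fun a b hab => by simpa using hab
  exact (iIndepFun_iff_map_fun_eq_pi_map fun k => (hX j k).aemeasurable).1 h1

theorem map_arr (hX : ∀ j k, Measurable (X j k))
    (hind : iIndepFun (fun q : Fin m × Fin n => X q.1 q.2) μ) :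
    μ.map (arr X) = Measure.pi (rowLaw μ X) := by
  have hmap := isProbabilityMeasure_map (μ := μ) hX
  have hpairs : μ.map (fun ω (q : Fin m × Fin n) => X q.1 q.2 ω)
      = Measure.pi fun q : Fin m × Fin n => μ.map (X q.1 q.2) :=
    (iIndepFun_iff_map_fun_eq_pi_map fun q : Fin m × Fin n => (hX q.1 q.2).aemeasurable).1 hind
  have hm : Measurable fun ω (q : Fin m × Fin n) => X q.1 q.2 ω :=
    measurable_pi_lambda _ fun q => hX q.1 q.2
  have hrow := isProbabilityMeasure_rowLaw (μ := μ) hX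
  have hcurry := Measure.infinitePi_map_curry fun j k => μ.map (X j k)
  simp only [Measure.infinitePi_eq_pi] at hcurry
  rw [← hpairs, Measure.map_map (MeasurableEquiv.measurable _) hm] at hcurry
  exact hcurry

theorem lintegral_arr (hX : ∀ j k, Measurable (X j k))
    (hind : iIndepFun (fun q : Fin m × Fin n => X q.1 q.2) μ) {f : (Fin m → Fin n → S) → ℝ≥0∞}
    (hf : Measurable f) : ∫⁻ ω, f (arr X ω) ∂μ = ∫⁻ x, f x ∂Measure.pi (rowLaw μ X) := by
  rw [← map_arr hX hind, lintegral_map hf (measurable_arr hX)]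

theorem measurable_resample (J : Finset (Fin m)) (x : Fin m → Fin n → S) :
    Measurable (resample J x) := by
  refine measurable_pi_lambda _ fun j => measurable_pi_lambda _ fun k => ?_
  unfold resample
  split_ifs <;> fun_prop

theorem lintegral_resample (hX : ∀ j k, Measurable (X j k))
    (hind : iIndepFun (fun q : Fin m × Fin n => X q.1 q.2) μ) {f : (Fin m → Fin n → S) → ℝ≥0∞}
    (hf : Measurable f) (J : Finset (Fin m)) (x : Fin m → Fin n → S) :
    ∫⁻ ω', f (resample J x (arr X ω')) ∂μ = (∫⋯∫⁻_J, f ∂rowLaw μ X) x := by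
  have := isProbabilityMeasure_rowLaw (μ := μ) hX
  have hg : Measurable fun y => f (resample J x y) := hf.comp (measurable_resample J x)
  rw [lintegral_arr hX hind hg, ← lintegral_lmarginal J hg]
  have e : ∀ z, (∫⋯∫⁻_J, (fun y => f (resample J x y)) ∂rowLaw μ X) z
      = (∫⋯∫⁻_J, f ∂rowLaw μ X) x := by
    intro z
    simp only [lmarginal]
    refine lintegral_congr fun w => ?_
    congr 1
    ext j k
    by_cases hj : j ∈ J <;> simp [resample, Function.updateFinset, hj]
  simp [e]

theorem partialSq_eq (hX : ∀ j k, Measurable (X j k))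
    (hind : iIndepFun (fun q : Fin m × Fin n => X q.1 q.2) μ) (hh : ∀ i, Measurable (h i))
    (J : Finset (Fin m)) (i : Fin m → Fin n) (x : Fin m → Fin n → S) :
    partialSq μ X h J i x = expOp (rowLaw μ X) J (sqFamily (arrKernel h)) i x := by
  have hm : Measurable (sqFamily (arrKernel h) i) := (measurable_arrKernel hh i).enorm.pow_const _
  rw [expOp, ← lintegral_resample hX hind hm, partialSq]
  refine lintegral_congr fun ω => ?_
  rw [sqFamily, Real.enorm_eq_ofReal_abs, ENNReal.ofReal_rpow_of_nonneg (abs_nonneg _)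
    (by norm_num), Real.rpow_two, sq_abs, arrKernel]

/-- The base index `i₀` is immaterial: its entries off `J` are summed over and those in `J` are
maximized over. It is present only because the operators act on full multi-indices. -/
theorem mixedMoment_eq (hX : ∀ j k, Measurable (X j k))
    (hind : iIndepFun (fun q : Fin m × Fin n => X q.1 q.2) μ) (hh : ∀ i, Measurable (h i))
    {p : ℝ} (hp : 0 < p) (J : Finset (Fin m)) (i₀ : Fin m → Fin n) :
    mixedMoment μ X h p J = prodMoment (rowLaw μ X) (arrKernel h) i₀ p J := by
  have := isProbabilityMeasure_rowLaw (μ := μ) hX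
  have hm : ∀ i, Measurable (sqFamily (arrKernel h) i) := fun i =>
    (measurable_arrKernel hh i).enorm.pow_const _
  rw [prodMoment, ← lintegral_arr hX hind
    ((measurable_maxOp (measurable_sumExp hm) i₀).pow_const _), mixedMoment]
  refine lintegral_congr fun ω => ?_
  have hmono : ∀ {α : Type} (a : α → ℝ≥0∞), ⨆ k, a k ^ (p / 2) = (⨆ k, a k) ^ (p / 2) :=
    fun a => ((ENNReal.orderIsoRpow (p / 2) (by positivity)).map_iSup a).symm
  rw [hmono]
  congr 1
  have hsum : ∀ (k : J → Fin n) (i' : Fin m → Fin n), (∀ j : J, i' j = k j) →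
      ∑ i : Fin m → Fin n with (∀ j : J, i j = k j), partialSq μ X h Jᶜ i (arr X ω)
        = sumExp (rowLaw μ X) Jᶜ (sqFamily (arrKernel h)) i' (arr X ω) := by
    intro k i' hk
    simp only [partialSq_eq hX hind hh, sumExp, sumOp]
    refine Finset.sum_congr ?_ fun _ _ => rfl
    ext i
    simp only [Finset.mem_filter, Finset.mem_univ, true_and, mem_idxClass, Finset.mem_compl,
      not_not]
    exact ⟨fun H j hj => (H ⟨j, hj⟩).trans (hk ⟨j, hj⟩).symm,
      fun H j => (H j j.2).trans (hk j)⟩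
  refine le_antisymm (iSup_le fun k => ?_) (iSup₂_le fun i' hi' => ?_)
  · have hi' : Function.updateFinset i₀ J k ∈ idxClass J i₀ := by
      rw [mem_idxClass]
      intro j hj
      simp [Function.updateFinset, hj]
    rw [hsum k (Function.updateFinset i₀ J k) fun j => by simp [Function.updateFinset]]
    exact le_iSup₂_of_le _ hi' le_rfl
  · refine le_iSup_of_le (fun j => i' j) (le_of_eq ?_)
    exact (hsum (fun j => i' j) i' fun _ => rfl).symm

/-- Enlarge the fibre sum to the sum over all indices, which removes the maximum; then Jensen moves
the expectation over the rows outside `J` out of the power `p/2`. -/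
theorem mixedMoment_le (hX : ∀ j k, Measurable (X j k))
    (hind : iIndepFun (fun q : Fin m × Fin n => X q.1 q.2) μ) (hh : ∀ i, Measurable (h i))
    {p : ℝ} (hp : 2 ≤ p) (J : Finset (Fin m)) :
    mixedMoment μ X h p J
      ≤ ∫⁻ x, (∑ i, ‖arrKernel h i x‖ₑ ^ (2 : ℝ)) ^ (p / 2) ∂Measure.pi (rowLaw μ X) := by
  have := isProbabilityMeasure_rowLaw (μ := μ) hX
  have hk := measurable_arrKernel hh
  have hf : Measurable fun x => (∑ i, ‖arrKernel h i x‖ₑ ^ (2 : ℝ)) ^ (p / 2) := by fun_prop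
  rw [← lintegral_lmarginal Jᶜ hf, ← lintegral_arr hX hind (hf.lmarginal _), mixedMoment]
  refine lintegral_mono fun ω => iSup_le fun k => ?_
  have hmi : ∀ i, Measurable fun y =>
      ‖arrKernel h i (Function.updateFinset (arr X ω) Jᶜ y)‖ₑ ^ (2 : ℝ) := fun i =>
    ((hk i).comp measurable_updateFinset).enorm.pow_const _
  refine le_trans ?_ (rpow_lintegral_le (r := p / 2) (f := fun y => ∑ i,
    ‖arrKernel h i (Function.updateFinset (arr X ω) Jᶜ y)‖ₑ ^ (2 : ℝ)) ?_ (by linarith))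
  · gcongr
    simp only [partialSq_eq hX hind hh]
    rw [lintegral_finsetSum _ fun i _ => hmi i]
    exact Finset.sum_le_sum_of_subset (Finset.filter_subset _ _)
  · exact (Finset.measurable_sum _ fun i _ => hmi i).aemeasurable

theorem canonicalFamily_arrKernel (hX : ∀ j k, Measurable (X j k))
    (hind : iIndepFun (fun q : Fin m × Fin n => X q.1 q.2) μ) (hh : ∀ i, Measurable (h i))
    (hint : ∀ i, Integrable (fun ω => h i (select i (arr X ω))) μ) (hcan : IsCanonical μ X h) :
    CanonicalFamily (rowLaw μ X) (arrKernel h) where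
  measurable := measurable_arrKernel hh
  integrable i := by
    rw [← map_arr hX hind, integrable_map_measure
      (measurable_arrKernel hh i).aestronglyMeasurable (measurable_arr hX).aemeasurable]
    exact hint i
  adapted i j x y y' hy := by
    simp only [arrKernel]
    congr 1
    ext l
    rcases eq_or_ne l j with rfl | hl
    · simp [select, hy]
    · simp [select, hl]
  centered i j := by
    have := isProbabilityMeasure_rowLaw (μ := μ) hX
    have hm : Measurable fun z : (Fin m → Fin n → S) × (Fin n → S) =>
      arrKernel h i (Function.update z.1 j z.2) :=
      (measurable_arrKernel hh i).comp measurable_update'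
    have hms : MeasurableSet {x : Fin m → Fin n → S |
        ∫ y, arrKernel h i (Function.update x j y) ∂rowLaw μ X j = 0} :=
      hm.stronglyMeasurable.integral_prod_right.measurable (measurableSet_singleton 0)
    rw [← map_arr hX hind, ae_map_iff (measurable_arr hX).aemeasurable hms]
    filter_upwards [hcan i j] with ω hω
    have hmy : Measurable fun y => arrKernel h i (Function.update (arr X ω) j y) :=
      hm.comp (measurable_const.prodMk measurable_id)
    rw [← map_row hX hind j, integral_map
      (measurable_pi_lambda _ fun k => hX j k).aemeasurable
      hmy.aestronglyMeasurable, ← hω]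
    refine integral_congr_ae (Filter.Eventually.of_forall fun ω' => ?_)
    simp only [arrKernel]
    congr 2
    ext l k
    rcases eq_or_ne l j with rfl | hl
    · simp [resample, arr]
    · simp [resample, hl]

end Transfer

/-! ### Markov's inequality at the tail infimum -/

section TailInfimum

variable {Ω : Type*} [MeasurableSpace Ω] {μ : Measure Ω} [IsProbabilityMeasure μ] {U : Ω → ℝ}

theorem rpow_mul_real_lt_abs_le (hU : Measurable U) {p t : ℝ} (hp : 0 ≤ p) (ht : 0 ≤ t)
    (hfin : ∫⁻ ω, ‖U ω‖ₑ ^ p ∂μ ≠ ∞) :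
    t ^ p * μ.real {ω | t < |U ω|} ≤ (∫⁻ ω, ‖U ω‖ₑ ^ p ∂μ).toReal := by
  have h := ENNReal.toReal_mono hfin (rpow_mul_measure_lt_abs_le (μ := μ) hU (t := t) hp)
  rwa [ENNReal.toReal_mul, ← ENNReal.toReal_rpow, ENNReal.toReal_ofReal ht] at h

theorem exists_real_lt_abs_le (hU : Measurable U) {p l : ℝ} (hp : 0 < p) (hl : 0 < l)
    (hfin : ∫⁻ ω, ‖U ω‖ₑ ^ p ∂μ ≠ ∞) :
    ∃ t : ℝ, 0 ≤ t ∧ μ.real {ω | t < |U ω|} ≤ l := by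
  set e := (∫⁻ ω, ‖U ω‖ₑ ^ p ∂μ).toReal with he
  have he0 : 0 ≤ e := ENNReal.toReal_nonneg
  have hpos : 0 < e / l + 1 := by positivity
  have ht0 : 0 ≤ (e / l + 1) ^ (1 / p) := by positivity
  refine ⟨(e / l + 1) ^ (1 / p), ht0, ?_⟩
  have h := rpow_mul_real_lt_abs_le (μ := μ) hU hp.le ht0 hfin
  rw [← he, ← Real.rpow_mul hpos.le, one_div_mul_cancel hp.ne', Real.rpow_one] at h
  refine le_of_mul_le_mul_left (h.trans ?_) hpos
  rw [add_mul, div_mul_cancel₀ _ hl.ne']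
  linarith

theorem mul_sInf_rpow_le (hU : Measurable U) {p l : ℝ} (hp : 0 < p) (hl : 0 < l) :
    ENNReal.ofReal (l * sInf {t : ℝ | 0 ≤ t ∧ μ.real {ω | t < |U ω|} ≤ l} ^ p)
      ≤ ∫⁻ ω, ‖U ω‖ₑ ^ p ∂μ := by
  by_cases hfin : ∫⁻ ω, ‖U ω‖ₑ ^ p ∂μ = ∞
  · simp [hfin]
  refine (ENNReal.ofReal_le_iff_le_toReal hfin).2 ?_
  set A := {t : ℝ | 0 ≤ t ∧ μ.real {ω | t < |U ω|} ≤ l}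
  have hT : 0 ≤ sInf A := Real.sInf_nonneg fun t ht => ht.1
  have hbdd : BddBelow A := ⟨0, fun t ht => ht.1⟩
  set e := (∫⁻ ω, ‖U ω‖ₑ ^ p ∂μ).toReal with he
  have he0 : 0 ≤ e := ENNReal.toReal_nonneg
  by_contra! hlt
  have h1 : (e / l) ^ (1 / p) < sInf A := by
    rw [one_div, Real.rpow_inv_lt_iff_of_pos (by positivity) hT hp, div_lt_iff₀ hl]
    linarith
  -- Any `t` below the infimum has tail above `l`, so Markov at a `t` slightly below it suffices and
  -- no continuity of the tail is needed.
  obtain ⟨t, ht1, ht2⟩ := exists_between h1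
  have ht0 : 0 ≤ t := le_trans (by positivity) ht1.le
  have htp : e / l < t ^ p := by
    rwa [one_div, Real.rpow_inv_lt_iff_of_pos (by positivity) ht0 hp] at ht1
  have hlev : l < μ.real {ω | t < |U ω|} := by
    by_contra! hc
    exact absurd (csInf_le hbdd ⟨ht0, hc⟩) (not_le.2 ht2)
  have h := rpow_mul_real_lt_abs_le (μ := μ) hU hp.le ht0 hfin
  have h2 : e < t ^ p * l := (div_lt_iff₀ hl).1 htp
  have h3 : t ^ p * l ≤ t ^ p * μ.real {ω | t < |U ω|} := by gcongr
  linarith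

end TailInfimum

/-! ### The upper bound on the product space -/

section UpperBound

variable {ι κ S : Type*} [Fintype ι] [DecidableEq ι] [Fintype κ] [DecidableEq κ]
  [MeasurableSpace S] {ρ : ι → κ → Measure S} [∀ j k, IsProbabilityMeasure (ρ j k)]
  {H : (ι → κ) → (ι → κ → S) → ℝ}

/-- The hypercontractivity constant for canonical sums dominated by their variance. -/
def hyperConst (m : ℕ) : ℕ := momentConst m ^ 4 * 32 ^ m

theorem one_le_hyperConst (m : ℕ) : 1 ≤ hyperConst m :=
  Nat.mul_pos (pow_pos (one_le_momentConst m) 4) (by positivity)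

/-- The square root of the constant `K_m`. -/
def tailConst (m : ℕ) : ℕ := 2 * 4 ^ m * hyperConst m

theorem one_le_tailConst (m : ℕ) : 1 ≤ tailConst m :=
  Nat.mul_pos (by positivity) (one_le_hyperConst m)

/-- For `q ≤ 4` all dependence on `q` disappears: `q^(mq/2) ≤ 16^m`, and the `2^m` sets `J` account
for the rest of `32^m`. -/
theorem CanonicalFamily.lintegral_rpow_le_hyperConst
    (hH : CanonicalFamily (fun j => Measure.pi (ρ j)) H) {q : ℝ} (hq : 2 < q) (hq4 : q ≤ 4)
    (i : ι → κ) {B : ℝ≥0∞} (hB : ∀ J : Finset ι, ENNReal.ofReal q ^ (J.card * q / 2) *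
      prodMoment (fun j => Measure.pi (ρ j)) H i q J ≤ B) :
    ∫⁻ x, ‖∑ i, H i x‖ₑ ^ q ∂Measure.pi (fun j => Measure.pi (ρ j))
      ≤ hyperConst (Fintype.card ι) * B := by
  have hC : (1 : ℝ≥0∞) ≤ (momentConst (Fintype.card ι) : ℝ≥0∞) := by
    exact_mod_cast one_le_momentConst _
  have h4 : ENNReal.ofReal q ≤ 4 := by
    rw [show (4 : ℝ≥0∞) = ENNReal.ofReal 4 by norm_num]
    exact ENNReal.ofReal_le_ofReal hq4
  calc _ ≤ _ := hH.lintegral_rpow_le_prodMoment hq i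
    _ ≤ (momentConst (Fintype.card ι) : ℝ≥0∞) ^ (4 : ℝ) * 4 ^ ((Fintype.card ι * 2 : ℕ) : ℝ) *
          ∑ _J : Finset ι, B := by
        gcongr with J
        · refine (ENNReal.rpow_le_rpow h4 (by positivity)).trans
            (ENNReal.rpow_le_rpow_of_exponent_le (by norm_num) ?_)
          push_cast
          nlinarith [(Fintype.card ι).cast_nonneg (α := ℝ)]
        · exact hB J
    _ = _ := by
        rw [Finset.sum_const, Finset.card_univ, Fintype.card_finset, ENNReal.rpow_natCast, pow_mul',
          show (4 : ℝ) = ((4 : ℕ) : ℝ) by norm_num, ENNReal.rpow_natCast, nsmul_eq_mul, hyperConst]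
        push_cast
        rw [show (32 : ℝ≥0∞) = 4 ^ 2 * 2 by norm_num, mul_pow]
        ring

/-- The moments of a canonical sum are controlled by its tail infimum and its conditional
variances. -/
theorem CanonicalFamily.lintegral_rpow_le_sInf
    (hH : CanonicalFamily (fun j => Measure.pi (ρ j)) H) {p : ℝ} (hp : 2 < p) (i : ι → κ)
    (hfin : ∫⁻ x, ‖∑ i, H i x‖ₑ ^ p ∂Measure.pi (fun j => Measure.pi (ρ j)) ≠ ∞) :
    ∫⁻ x, ‖∑ i, H i x‖ₑ ^ p ∂Measure.pi (fun j => Measure.pi (ρ j))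
      ≤ 2 * (momentConst (Fintype.card ι) : ℝ≥0∞) ^ p *
        ENNReal.ofReal p ^ (Fintype.card ι * p / 2) *
        ((2 * 4 ^ Fintype.card ι) ^ p * ENNReal.ofReal (sInf {t : ℝ | 0 ≤ t ∧
          (Measure.pi fun j => Measure.pi (ρ j)).real {x | t < |∑ i, H i x|}
            ≤ level ((tailConst (Fintype.card ι) : ℝ) ^ 2) (Fintype.card ι) p}) ^ p
        + ∑ J : Finset ι with J.Nonempty, ENNReal.ofReal p ^ (J.card * p / 2) *
            prodMoment (fun j => Measure.pi (ρ j)) H i p J) := by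
  have hp0 : 0 < p := by linarith
  have hU : Measurable fun x => ∑ i, H i x := Finset.measurable_sum _ fun i _ => hH.measurable i
  have hmom := hH.lintegral_rpow_le_prodMoment hp i
  have hEmp := fun q => prodMoment_empty (ρ := ρ) i q hH.measurable
  have hVU := hH.squareFunction_le_lintegral_rpow (p := 2) le_rfl
  have hL := fun q => prodMoment_le_rpow (ρ := ρ) (q := q) i hH.measurable (p := p)
  have hE2 : ∫⁻ x, ‖∑ i, H i x‖ₑ ^ (2 : ℝ) ∂Measure.pi (fun j => Measure.pi (ρ j)) ≠ ∞ :=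
    ((lintegral_rpow_le_rpow_lintegral hU.enorm.aemeasurable (by norm_num) hp.le).trans_lt
      (ENNReal.rpow_lt_top_of_nonneg (by positivity) hfin)).ne
  have hhyp := fun q hq hq4 B => hH.lintegral_rpow_le_hyperConst (q := q) hq hq4 i (B := B)
  set P := Measure.pi fun j => Measure.pi (ρ j)
  set m := Fintype.card ι
  set M := prodMoment (fun j => Measure.pi (ρ j)) H i
  set V := ∫⁻ x, ∑ i, ‖H i x‖ₑ ^ (2 : ℝ) ∂P
  simp only [div_self (two_ne_zero' ℝ), ENNReal.rpow_one] at hVU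
  have hVU' : V ≤ (4 ^ m : ℕ) * ∫⁻ x, ‖∑ i, H i x‖ₑ ^ (2 : ℝ) ∂P := by
    refine hVU.trans_eq ?_
    norm_num
  have hV : V ≠ ∞ := (hVU'.trans_lt (ENNReal.mul_lt_top (ENNReal.natCast_lt_top _) hE2.lt_top)).ne
  have hsplit : ∑ J : Finset ι, ENNReal.ofReal p ^ (J.card * p / 2) * M p J
      = V ^ (p / 2) + ∑ J : Finset ι with J.Nonempty,
          ENNReal.ofReal p ^ (J.card * p / 2) * M p J := by
    have : (Finset.univ.filter fun J : Finset ι => J.Nonempty) = Finset.univ.erase ∅ := by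
      ext J; simp [Finset.nonempty_iff_ne_empty]
    rw [this, ← Finset.add_sum_erase _ _ (Finset.mem_univ ∅), hEmp]
    simp
  rw [hsplit] at hmom
  set R := ∑ J : Finset ι with J.Nonempty, ENNReal.ofReal p ^ (J.card * p / 2) * M p J with hR
  -- `V ^ (p / 2)` is the term of the empty set and `R` collects all others; the factor `2` in the
  -- conclusion comes from this dichotomy.
  rcases le_total (V ^ (p / 2)) R with hcase | hcase
  · calc _ ≤ _ := hmom
      _ ≤ (momentConst m : ℝ≥0∞) ^ p * ENNReal.ofReal p ^ (m * p / 2) * (R + R) := by gcongr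
      _ = 2 * (momentConst m : ℝ≥0∞) ^ p * ENNReal.ofReal p ^ (m * p / 2) * R := by ring
      _ ≤ _ := by gcongr; exact le_add_self
  · have hdom : ∀ J : Finset ι, ENNReal.ofReal p ^ (J.card * p / 2) * M p J ≤ V ^ (p / 2) := by
      intro J
      rcases J.eq_empty_or_nonempty with rfl | hJ
      · rw [hEmp]; simp
      · refine le_trans ?_ hcase
        exact Finset.single_le_sum (f := fun J : Finset ι =>
          ENNReal.ofReal p ^ (J.card * p / 2) * M p J) (fun _ _ => zero_le) (by simp [hJ])
    have hq2 : 2 < min p 4 := lt_min hp (by norm_num)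
    have hqp : min p 4 ≤ p := min_le_left _ _
    have hq4 : min p 4 ≤ 4 := min_le_right _ _
    have hNV : ∀ J : Finset ι, ENNReal.ofReal (min p 4) ^ (J.card * min p 4 / 2) * M (min p 4) J
        ≤ V ^ (min p 4 / 2) := by
      intro J
      set q := min p 4
      have hq0 : 0 < q := by linarith
      calc _ ≤ ENNReal.ofReal p ^ (J.card * q / 2) * M p J ^ (q / p) := by
            gcongr
            exact hL q hq0 hqp J
        _ = (ENNReal.ofReal p ^ (J.card * p / 2) * M p J) ^ (q / p) := by
            rw [ENNReal.mul_rpow_of_nonneg _ _ (by positivity), ← ENNReal.rpow_mul]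
            congr 2
            field_simp
        _ ≤ (V ^ (p / 2)) ^ (q / p) := by gcongr; exact hdom J
        _ = V ^ (q / 2) := by
            rw [← ENNReal.rpow_mul]
            congr 1
            field_simp
    have hUq := hhyp _ hq2 hq4 _ hNV
    have hN : (1 : ℝ) ≤ tailConst m := by exact_mod_cast one_le_tailConst m
    have hVt : ∀ t : ℝ, 0 ≤ t ∧ P.real {x | t < |∑ i, H i x|} ≤ level ((tailConst m : ℝ) ^ 2) m p →
        V.toReal / (2 * 4 ^ m) ≤ t ^ 2 := by
      rintro t ⟨ht0, ht⟩
      -- Here `c = 4 ^ m` and `D = hyperConst m`, so that `2 * c * D` is exactly `tailConst m`.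
      have h := le_sq_of_tail_le hU hq2 hV (Nat.one_le_pow _ _ (by norm_num))
        (one_le_hyperConst m) hVU' hUq (t := t) (ht.trans ((level_sq_le hN m hp).trans_eq
          (by rw [tailConst]; push_cast; rfl)))
      have h' := ENNReal.toReal_mono (by
        refine ENNReal.mul_ne_top (ENNReal.mul_ne_top (by simp) (ENNReal.natCast_ne_top _)) ?_
        exact ENNReal.rpow_ne_top_of_nonneg (by norm_num) ENNReal.ofReal_ne_top) h
      rw [div_le_iff₀ (by positivity)]
      simp only [ENNReal.toReal_mul, ← ENNReal.toReal_rpow, ENNReal.toReal_ofReal ht0,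
        ENNReal.toReal_natCast, Real.rpow_two] at h'
      push_cast at h'
      simp only [ENNReal.toReal_ofNat] at h'
      linarith
    set A := {t : ℝ | 0 ≤ t ∧ P.real {x | t < |∑ i, H i x|} ≤ level ((tailConst m : ℝ) ^ 2) m p}
    -- Needed because the real infimum of the empty set is `0`, which would bound nothing; this is
    -- where finiteness of the `p`-th moment enters.
    have hA : A.Nonempty := exists_real_lt_abs_le hU hp0 (level_pos (by positivity) m hp) hfin
    have hsqrt : √(V.toReal / (2 * 4 ^ m)) ≤ sInf A := le_csInf hA fun t ht =>
      (Real.sqrt_le_left ht.1).2 (hVt t ht)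
    have hVT : V ≤ 2 * 4 ^ m * ENNReal.ofReal (sInf A) ^ (2 : ℝ) := by
      have h1 : V.toReal ≤ 2 * 4 ^ m * sInf A ^ 2 := by
        rw [← div_le_iff₀' (by positivity)]
        exact (Real.sqrt_le_left ((Real.sqrt_nonneg _).trans hsqrt)).1 hsqrt
      rw [← ENNReal.ofReal_toReal hV]
      refine (ENNReal.ofReal_le_ofReal h1).trans_eq ?_
      rw [ENNReal.ofReal_mul (by positivity), ENNReal.ofReal_mul (by positivity),
        ENNReal.ofReal_pow ((Real.sqrt_nonneg _).trans hsqrt), ENNReal.ofReal_pow (by norm_num),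
        ENNReal.rpow_two]
      norm_num
    calc _ ≤ _ := hmom
      _ ≤ (momentConst m : ℝ≥0∞) ^ p * ENNReal.ofReal p ^ (m * p / 2) *
            (V ^ (p / 2) + V ^ (p / 2)) := by gcongr
      _ = 2 * (momentConst m : ℝ≥0∞) ^ p * ENNReal.ofReal p ^ (m * p / 2) * V ^ (p / 2) := by ring
      _ ≤ 2 * (momentConst m : ℝ≥0∞) ^ p * ENNReal.ofReal p ^ (m * p / 2) *
            ((2 * 4 ^ m) ^ p * ENNReal.ofReal (sInf A) ^ p) := by
          gcongr
          calc V ^ (p / 2) ≤ (2 * 4 ^ m * ENNReal.ofReal (sInf A) ^ (2 : ℝ)) ^ (p / 2) := by gcongr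
            _ = (2 * 4 ^ m) ^ (p / 2) * ENNReal.ofReal (sInf A) ^ p := by
              rw [ENNReal.mul_rpow_of_nonneg _ _ (by positivity), ← ENNReal.rpow_mul,
                mul_div_cancel₀ _ two_ne_zero]
            _ ≤ _ := by
              gcongr
              · have : (1 : ℝ≥0∞) ≤ 4 ^ m := one_le_pow₀ (by norm_num)
                calc (1 : ℝ≥0∞) ≤ 1 * 1 := by simp
                  _ ≤ _ := by gcongr; norm_num
              · linarith
      _ ≤ _ := by gcongr; exact le_self_add

end UpperBound

/-! ### Matching the constants and the main theorem -/

theorem mul_momentConst_le_tailConst_sq (m : ℕ) :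
    (2 * 4 ^ m * momentConst m : ℝ) ≤ (tailConst m : ℝ) ^ 2 := by
  have h1 : 2 * 4 ^ m * momentConst m ≤ tailConst m ^ 2 := by
    have h2 : momentConst m ≤ hyperConst m :=
      calc momentConst m = momentConst m ^ 1 * 1 := by simp
        _ ≤ momentConst m ^ 4 * 32 ^ m :=
          Nat.mul_le_mul (Nat.pow_le_pow_right (one_le_momentConst m) (by norm_num))
            (Nat.one_le_pow _ _ (by norm_num))
    calc 2 * 4 ^ m * momentConst m ≤ tailConst m := Nat.mul_le_mul_left _ h2
      _ ≤ tailConst m ^ 2 := Nat.le_self_pow two_ne_zero _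
  exact_mod_cast h1

/-- The factor `(2 * 4 ^ m) ^ p` in front of `t ^ p` is absorbed into `K ^ p`; the `2 ^ p` on the
right is pure slack. -/
theorem moment_bound_le {m : ℕ} {p K C t : ℝ} (hp : 0 < p) (ht : 0 ≤ t) (hC : 0 ≤ C)
    (hK : 2 * 4 ^ m * C ≤ K) (M : Finset (Fin m) → ℝ≥0∞) :
    2 * ENNReal.ofReal C ^ p * ENNReal.ofReal p ^ (m * p / 2) *
        ((2 * 4 ^ m) ^ p * ENNReal.ofReal t ^ p
          + ∑ J : Finset (Fin m) with J.Nonempty, ENNReal.ofReal p ^ (J.card * p / 2) * M J)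
      ≤ ENNReal.ofReal (2 * K ^ p) *
        (ENNReal.ofReal ((2 * p ^ ((m : ℝ) / 2)) ^ p * t ^ p)
          + ∑ J : Finset (Fin m) with J.Nonempty,
              ENNReal.ofReal (p ^ (((m : ℝ) + J.card) * p / 2)) * M J) := by
  have h4 : (1 : ℝ) ≤ 4 ^ m := one_le_pow₀ (by norm_num)
  have hCK : C ≤ K := by nlinarith
  have hK0 : 0 ≤ K := hC.trans hCK
  have hpow : ∀ a : ℝ, ENNReal.ofReal p ^ a = ENNReal.ofReal (p ^ a) := fun a =>
    ENNReal.ofReal_rpow_of_pos hp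
  have hCp : 2 * ENNReal.ofReal C ^ p = ENNReal.ofReal (2 * C ^ p) := by
    rw [ENNReal.ofReal_mul two_pos.le, ENNReal.ofReal_rpow_of_nonneg hC hp.le, ENNReal.ofReal_ofNat]
  have h24 : (2 * 4 ^ m : ℝ≥0∞) ^ p = ENNReal.ofReal ((2 * 4 ^ m) ^ p) := by
    rw [← ENNReal.ofReal_rpow_of_nonneg (by positivity) hp.le, ENNReal.ofReal_mul two_pos.le,
      ENNReal.ofReal_pow (by norm_num)]
    simp
  simp only [mul_add, Finset.mul_sum]
  refine add_le_add ?_ (Finset.sum_le_sum fun J _ => ?_)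
  · rw [hCp, hpow, h24, ENNReal.ofReal_rpow_of_nonneg ht hp.le,
      ← ENNReal.ofReal_mul (by positivity), ← ENNReal.ofReal_mul (by positivity),
      ← ENNReal.ofReal_mul (by positivity), ← ENNReal.ofReal_mul (by positivity)]
    refine ENNReal.ofReal_le_ofReal ?_
    have e1 : (2 * p ^ ((m : ℝ) / 2)) ^ p = 2 ^ p * p ^ (m * p / 2) := by
      rw [Real.mul_rpow two_pos.le (by positivity), ← Real.rpow_mul hp.le]
      ring_nf
    have e2 : C ^ p * (2 * 4 ^ m) ^ p ≤ K ^ p := by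
      rw [← Real.mul_rpow hC (by positivity)]
      exact Real.rpow_le_rpow (by positivity) (by linarith) hp.le
    have e3 : (1 : ℝ) ≤ 2 ^ p := Real.one_le_rpow (by norm_num) hp.le
    calc 2 * C ^ p * p ^ (m * p / 2) * ((2 * 4 ^ m) ^ p * t ^ p)
        = 2 * (C ^ p * (2 * 4 ^ m) ^ p) * (1 * p ^ (m * p / 2) * t ^ p) := by ring
      _ ≤ 2 * K ^ p * (2 ^ p * p ^ (m * p / 2) * t ^ p) := by gcongr
      _ = _ := by rw [e1]
  · rw [hCp, hpow, hpow, ← mul_assoc, ← mul_assoc, ← ENNReal.ofReal_mul (by positivity),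
      ← ENNReal.ofReal_mul (by positivity), ← ENNReal.ofReal_mul (by positivity),
      mul_assoc (2 * C ^ p), ← Real.rpow_add hp, ← add_div, ← add_mul]
    gcongr

end DecoupledU

theorem theorem2p5 :
    ∃ K : ℕ → ℝ, (∀ m, 0 < K m) ∧
      ∀ (m n : ℕ), 1 ≤ m →
      ∀ (Ω : Type*) [MeasurableSpace Ω] (μ : Measure Ω) [IsProbabilityMeasure μ]
        (S : Type*) [MeasurableSpace S]
        (X : Fin m → Fin n → Ω → S) (h : (Fin m → Fin n) → (Fin m → S) → ℝ) (p : ℝ),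
        2 < p →
        (∀ j i, Measurable (X j i)) →
        iIndepFun (fun q : Fin m × Fin n => X q.1 q.2) μ →
        (∀ i, Measurable (h i)) →
        (∀ i, MemLp (fun ω => h i (DecoupledU.select i (DecoupledU.arr X ω)))
          (ENNReal.ofReal p) μ) →
        DecoupledU.IsCanonical μ X h →
        (ENNReal.ofReal
              (1 / (4 * K m * p ^ ((m : ℝ) / 2)) ^ (p / (p - 2))
                * DecoupledU.t0 μ X h (K m) p ^ p)
            ⊔ ENNReal.ofReal (2 ^ (-((m : ℝ) * p))) *
                ⨆ (J : Finset (Fin m)) (_ : J.Nonempty), DecoupledU.mixedMoment μ X h p J)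
          ≤ ∫⁻ ω, ENNReal.ofReal (|DecoupledU.uStat X h ω| ^ p) ∂μ
        ∧ ∫⁻ ω, ENNReal.ofReal (|DecoupledU.uStat X h ω| ^ p) ∂μ
          ≤ ENNReal.ofReal (2 * K m ^ p) *
              (ENNReal.ofReal
                  ((2 * p ^ ((m : ℝ) / 2)) ^ p * DecoupledU.t0 μ X h (K m) p ^ p)
                + ∑ J : Finset (Fin m) with J.Nonempty,
                    ENNReal.ofReal (p ^ (((m : ℝ) + J.card) * p / 2)) *
                      DecoupledU.mixedMoment μ X h p J) := by
  refine ⟨fun m => (DecoupledU.tailConst m : ℝ) ^ 2, fun m => ?_, ?_⟩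
  · have := DecoupledU.one_le_tailConst m
    positivity
  intro m n hm Ω _ μ _ S _ X h p hp hX hind hh hLp hcan
  have hp0 : 0 < p := by linarith
  have hmap := DecoupledU.isProbabilityMeasure_map (μ := μ) hX
  have hN : (1 : ℝ) ≤ DecoupledU.tailConst m := by
    exact_mod_cast DecoupledU.one_le_tailConst m
  have hK : 0 < (DecoupledU.tailConst m : ℝ) ^ 2 := by positivity
  have hKC : (2 * 4 ^ m * DecoupledU.momentConst m : ℝ) ≤ (DecoupledU.tailConst m : ℝ) ^ 2 :=
    DecoupledU.mul_momentConst_le_tailConst_sq m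
  have hint : ∀ i, Integrable (fun ω => h i (DecoupledU.select i (DecoupledU.arr X ω))) μ :=
    fun i => (hLp i).integrable (by rw [ENNReal.one_le_ofReal]; linarith)
  have hH := DecoupledU.canonicalFamily_arrKernel hX hind hh hint hcan
  have hU : Measurable (DecoupledU.uStat X h) := Finset.measurable_sum _ fun i _ =>
    (DecoupledU.measurable_arrKernel hh i).comp (DecoupledU.measurable_arr hX)
  have hUm : Measurable fun x => ∑ i, DecoupledU.arrKernel h i x :=
    Finset.measurable_sum _ fun i _ => DecoupledU.measurable_arrKernel hh i
  have hEU : ∫⁻ ω, ENNReal.ofReal (|DecoupledU.uStat X h ω| ^ p) ∂μ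
      = ∫⁻ ω, ‖DecoupledU.uStat X h ω‖ₑ ^ p ∂μ := lintegral_congr fun ω => by
    rw [Real.enorm_eq_ofReal_abs, ENNReal.ofReal_rpow_of_nonneg (abs_nonneg _) hp0.le]
  have hEP : ∫⁻ ω, ‖DecoupledU.uStat X h ω‖ₑ ^ p ∂μ
      = ∫⁻ x, ‖∑ i, DecoupledU.arrKernel h i x‖ₑ ^ p ∂Measure.pi (DecoupledU.rowLaw μ X) :=
    DecoupledU.lintegral_arr hX hind (hUm.enorm.pow_const p)
  have hfin : ∫⁻ ω, ‖DecoupledU.uStat X h ω‖ₑ ^ p ∂μ ≠ ∞ := by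
    have h1 : MemLp (DecoupledU.uStat X h) (ENNReal.ofReal p) μ :=
      memLp_finsetSum _ fun i _ => hLp i
    have h2 := lintegral_rpow_enorm_lt_top_of_eLpNorm_lt_top (by simpa using hp0)
      ENNReal.ofReal_ne_top h1.2
    rw [ENNReal.toReal_ofReal hp0.le] at h2
    exact h2.ne
  have ht0 : 0 ≤ DecoupledU.t0 μ X h ((DecoupledU.tailConst m : ℝ) ^ 2) p :=
    Real.sInf_nonneg fun t ht => ht.1
  rw [hEU]
  refine ⟨sup_le ?_ ?_, ?_⟩
  · refine le_trans (ENNReal.ofReal_le_ofReal ?_)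
      (DecoupledU.mul_sInf_rpow_le hU hp0 (DecoupledU.level_pos hK m hp))
    exact mul_le_mul_of_nonneg_right (DecoupledU.inv_rpow_le_level hK m hp) (by positivity)
  · have hsq := hH.squareFunction_le_lintegral_rpow hp.le
    rw [Fintype.card_fin] at hsq
    have hsup : ⨆ (J : Finset (Fin m)) (_ : J.Nonempty), DecoupledU.mixedMoment μ X h p J
        ≤ (2 ^ p) ^ m * ∫⁻ ω, ‖DecoupledU.uStat X h ω‖ₑ ^ p ∂μ := by
      rw [hEP]
      exact iSup₂_le fun J _ => (DecoupledU.mixedMoment_le hX hind hh hp.le J).trans hsq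
    refine (mul_le_mul_right hsup _).trans_eq ?_
    have e : ENNReal.ofReal (2 ^ (-((m : ℝ) * p))) * (2 ^ p) ^ m = 1 := by
      rw [← ENNReal.ofReal_rpow_of_pos two_pos, ENNReal.ofReal_ofNat, ← ENNReal.rpow_natCast,
        ← ENNReal.rpow_mul, ← ENNReal.rpow_add _ _ (by simp) (by simp), mul_comm p,
        neg_add_cancel, ENNReal.rpow_zero]
    rw [← mul_assoc, e, one_mul]
  -- With no multi-indices (`n = 0`) there is no base index, but the statistic vanishes.
  rcases isEmpty_or_nonempty (Fin m → Fin n) with hemp | ⟨⟨i₀⟩⟩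
  · have : ∀ ω, DecoupledU.uStat X h ω = 0 := fun ω => by simp [DecoupledU.uStat]
    simp [this, hp0]
  have hT : DecoupledU.t0 μ X h ((DecoupledU.tailConst m : ℝ) ^ 2) p
      = sInf {t : ℝ | 0 ≤ t ∧ (Measure.pi (DecoupledU.rowLaw μ X)).real
          {x | t < |∑ i, DecoupledU.arrKernel h i x|}
            ≤ DecoupledU.level ((DecoupledU.tailConst m : ℝ) ^ 2) m p} := by
    have : ∀ t : ℝ, (Measure.pi (DecoupledU.rowLaw μ X)).real
        {x | t < |∑ i, DecoupledU.arrKernel h i x|}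
          = μ.real {ω | t < |DecoupledU.uStat X h ω|} := by
      intro t
      rw [← DecoupledU.map_arr hX hind, map_measureReal_apply (DecoupledU.measurable_arr hX)
        (measurableSet_lt measurable_const hUm.abs)]
      rfl
    simp only [this]
    rfl
  have hmain := hH.lintegral_rpow_le_sInf hp i₀ (hEP ▸ hfin)
  rw [Fintype.card_fin] at hmain
  have hmain' := (hEP.trans_le hmain)
  change _ ≤ _ * ((2 * 4 ^ m) ^ p * ENNReal.ofReal (sInf {t : ℝ | 0 ≤ t ∧
    (Measure.pi (DecoupledU.rowLaw μ X)).real {x | t < |∑ i, DecoupledU.arrKernel h i x|}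
      ≤ DecoupledU.level ((DecoupledU.tailConst m : ℝ) ^ 2) m p}) ^ p
    + ∑ J : Finset (Fin m) with J.Nonempty, ENNReal.ofReal p ^ (J.card * p / 2) *
      DecoupledU.prodMoment (DecoupledU.rowLaw μ X) (DecoupledU.arrKernel h) i₀ p J) at hmain'
  rw [← hT] at hmain'
  simp only [← DecoupledU.mixedMoment_eq hX hind hh hp0] at hmain'
  have hC : (DecoupledU.momentConst m : ℝ≥0∞)
      = ENNReal.ofReal (DecoupledU.momentConst m : ℝ) := (ENNReal.ofReal_natCast _).symm
  rw [hC] at hmain'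
  exact hmain'.trans (DecoupledU.moment_bound_le hp0 ht0 (Nat.cast_nonneg _) hKC _)
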